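/- **Theorem (Recurrence for $k$ shift operators on $\{0,1\}^{\mathbb N^k}$).** Let $k\ge 1$ and let $\mathcal X=\{0,1\}^{\mathbb N^k}$, with the product topology and the product measure $\lambda$ of the uniform measure on $\{0,1\}$. For $1\le i\le k$ let $T_i\colon\mathcal X\to\mathcal X$ be the face shift $$T_i(Z)(u_1,\dots,u_k)=Z(u_1,\dots,u_i+1,\dots,u_k).$$ Say that $Z\in\mathcal X$ is *recurrent* in $\mathcal P\subseteq\mathcal X$ if there is $n\ge 1$ with $Z\in\bigcap_{1\le i\le k}T_i^{-n}(\mathcal P)$. In Cantor space $\{0,1\}^{\mathbb N}$ with the uniform product measure, also written $\lambda$, a $\Sigma^0_1$ class is the set of all sequences that extend some string in a given computably enumerable set of finite binary strings, and a $\Pi^0_1$ class is the complement of a $\Sigma^0_1$ class. A *Martin-Löf test* is a uniformly $\Sigma^0_1$ sequence $(U_m)_{m\in\mathbb N}$ with $\lambda U_m\le 2^{-m}$ for all $m$; it is a *Schnorr test* if moreover the reals $\lambda U_m$ are computable uniformly in $m$. A sequence is *Martin-Löf random* (*Schnorr random*) if it is not in $\bigcap_m U_m$ for any Martin-Löf test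 (Schnorr test) $(U_m)$, and *Kurtz random* if it is in no $\Pi^0_1$ class of measure $0$. All these notions are transferred to $\mathcal X$ through the isomorphism $\mathcal X\to\{0,1\}^{\mathbb N}$ induced by a computable bijection $e\colon\mathbb N^k\to\mathbb N$; the theorem holds for every such $e$. Let $\mathcal P\subseteq\mathcal X$ be a $\Pi^0_1$ class with $\lambda\mathcal P>0$, and let $Z\in\mathcal X$. Then: (a) if $Z$ is Kurtz random and $\mathcal P$ is clopen, then $Z$ is recurrent in $\mathcal P$; (b) if $Z$ is Schnorr random and $\lambda\mathcal P$ is a computable real, then $Z$ is recurrent in $\mathcal P$; (c) if $Z$ is Martin-Löf random, then $Z$ is recurrent in $\mathcal P$. -/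

import Mathlib

open MeasureTheory
open scoped ENNReal

noncomputable section

/-- The product measure on `{0,1}^ι` in which every coordinate is a fair coin.
It is used for Cantor space (`ι = ℕ`) and for `{0,1}^{ℕ^k}` (`ι = Fin k → ℕ`). -/
def coinMeasure (ι : Type) : Measure (ι → Bool) :=
  Measure.infinitePi fun _ => (PMF.uniformOfFintype Bool).toMeasure

/-- The finite string `σ` is an initial segment of the infinite sequence `Y`. -/
def IsInitialSegment (σ : List Bool) (Y : ℕ → Bool) : Prop :=
  ∀ (i : ℕ) (h : i < σ.length), Y i = σ[i]

/-- The open subset of Cantor space generated by a set of strings. -/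
def openClass (S : Set (List Bool)) : Set (ℕ → Bool) :=
  {Y | ∃ σ ∈ S, IsInitialSegment σ Y}

/-- `U` is a `Σ⁰₁` class in Cantor space: it is generated by a c.e. set of strings. -/
def IsSigma01 (U : Set (ℕ → Bool)) : Prop :=
  ∃ S : Set (List Bool), REPred (fun σ => σ ∈ S) ∧ U = openClass S

/-- `P` is a `Π⁰₁` class in Cantor space. -/
def IsPi01 (P : Set (ℕ → Bool)) : Prop := IsSigma01 Pᶜ

/-- The classes `U 0, U 1, …` are `Σ⁰₁` uniformly: they are generated by a uniformly c.e.
sequence of sets of strings. -/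
def IsUniformlySigma01 (U : ℕ → Set (ℕ → Bool)) : Prop :=
  ∃ S : ℕ → Set (List Bool),
    REPred (fun p : ℕ × List Bool => p.2 ∈ S p.1) ∧ ∀ m, U m = openClass (S m)

/-- `x` is a computable real: some computable sequence of dyadic rationals
`(a n - b n) / 2 ^ n`, given by natural numbers `a n` and `b n`, approximates it
with error at most `2 ^ (-n)`. -/
def IsComputableReal (x : ℝ) : Prop :=
  ∃ a b : ℕ → ℕ, Computable a ∧ Computable b ∧
    ∀ n, |x - ((a n : ℝ) - (b n : ℝ)) / 2 ^ n| ≤ (1 / 2 : ℝ) ^ n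

/-- The reals `x 0, x 1, …` are computable uniformly in the index. -/
def IsUniformlyComputableReal (x : ℕ → ℝ) : Prop :=
  ∃ a b : ℕ → ℕ → ℕ, Computable₂ a ∧ Computable₂ b ∧
    ∀ m n, |x m - ((a m n : ℝ) - (b m n : ℝ)) / 2 ^ n| ≤ (1 / 2 : ℝ) ^ n

/-- Martin-Löf tests. -/
def IsMLTest (U : ℕ → Set (ℕ → Bool)) : Prop :=
  IsUniformlySigma01 U ∧ ∀ m, coinMeasure ℕ (U m) ≤ (2⁻¹ : ℝ≥0∞) ^ m

/-- Schnorr tests: Martin-Löf tests whose components have uniformly computable measure. -/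
def IsSchnorrTest (U : ℕ → Set (ℕ → Bool)) : Prop :=
  IsMLTest U ∧ IsUniformlyComputableReal fun m => (coinMeasure ℕ (U m)).toReal

/-- `Z` is Kurtz (weakly) random: it lies in no null `Π⁰₁` class. -/
def IsKurtzRandom (Z : ℕ → Bool) : Prop :=
  ∀ Q : Set (ℕ → Bool), IsPi01 Q → coinMeasure ℕ Q = 0 → Z ∉ Q

/-- `Z` is Schnorr random: it passes every Schnorr test. -/
def IsSchnorrRandom (Z : ℕ → Bool) : Prop :=
  ∀ U : ℕ → Set (ℕ → Bool), IsSchnorrTest U → Z ∉ ⋂ m, U m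

/-- `Z` is Martin-Löf random: it passes every Martin-Löf test. -/
def IsMLRandom (Z : ℕ → Bool) : Prop :=
  ∀ U : ℕ → Set (ℕ → Bool), IsMLTest U → Z ∉ ⋂ m, U m

/-- The isomorphism from `{0,1}^{ℕ^k}` to Cantor space given by a bijection `e` from `ℕ^k`
to `ℕ`: bit `u` of an array becomes bit `e u` of a sequence. For computable `e`, effective
notions are transferred to `{0,1}^{ℕ^k}` along it. -/
def toCantor {k : ℕ} (e : (Fin k → ℕ) ≃ ℕ) : ((Fin k → ℕ) → Bool) ≃ (ℕ → Bool) :=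
  e.arrowCongr (Equiv.refl Bool)

/-- For `k ≥ 1` there is a computable bijection from `ℕ^k` to `ℕ`, so the effective notions on
`{0,1}^{ℕ^k}` are available. -/
theorem exists_computable_equiv (k : ℕ) (hk : 1 ≤ k) :
    ∃ e : (Fin k → ℕ) ≃ ℕ, Computable e := by
  induction k, hk using Nat.le_induction with
  | base =>
    refine ⟨Equiv.funUnique (Fin 1) ℕ, ?_⟩
    exact Computable.fin_app.comp Computable.id (Computable.const (0 : Fin 1))
  | succ k hk ih =>
    obtain ⟨e, he⟩ := ih
    refine ⟨(Fin.consEquiv (fun _ => ℕ)).symm.trans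
      ((Equiv.prodCongr (Equiv.refl ℕ) e).trans Nat.pairEquiv), ?_⟩
    have h0 : Primrec (fun u : Fin (k+1) → ℕ => u 0) :=
      Primrec.fin_app.comp Primrec.id (Primrec.const 0)
    have h1 : Primrec (fun (u : Fin (k+1) → ℕ) => (fun i : Fin k => u i.succ)) := by
      rw [Primrec.fin_curry]
      exact Primrec.fin_app.comp Primrec.fst (Primrec.fin_succ.comp Primrec.snd)
    exact (Primrec₂.natPair.to_comp).comp h0.to_comp (he.comp h1.to_comp)

/-- The face shift in direction `i`: `(T_i Z)(u) = Z(u_1, …, u_i + 1, …, u_k)`. -/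
def faceShift {k : ℕ} (i : Fin k) (Z : (Fin k → ℕ) → Bool) : (Fin k → ℕ) → Bool :=
  fun u => Z (Function.update u i (u i + 1))

/-- `Z` is recurrent in `P`: for some `n ≥ 1`, `n` iterations of each of the face shifts
take `Z` into `P`. -/
def IsRecurrentIn {k : ℕ} (Z : (Fin k → ℕ) → Bool) (P : Set ((Fin k → ℕ) → Bool)) : Prop :=
  ∃ n : ℕ, 1 ≤ n ∧ Z ∈ ⋂ i : Fin k, (faceShift i)^[n] ⁻¹' P

end

/-! Code `Z` as a sequence `Y` in Cantor space, and let `V` be the complement of the coded class,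
generated by computably enumerated strings `σ`. The `n`-th iterate of the `i`-th shift is `Y` read
along a map `f n i`, so `Z` misses `P` at time `n` exactly when one of these `k` subsequences lies
in `V`: this is a hit, `Y ∈ hitSet σ (f n)`. A non-recurrent `Z` is hit at every `n ≥ 1`.

For large `n` the `k` maps send a given initial block to disjoint sets of coordinates. Approximating
`V` by finitely many cylinders, one gets near-independence of the `k` conditions, so a hit has
probability at most some `q < 1` (`exists_coinMeasure_hitSet_le`). Now search greedily: after a hit
seen at stage `M`, pass to an `n` so large that only bits from position `M` on are read. The next
hit is independent of the past, so `r` successive hits have probability at most `q ^ r`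
(`coinMeasure_hitsEver_le`), while a non-recurrent `Z` yields infinitely many.

The number of hits by a given stage is computable from finitely many bits, so having at least `c *
m` hits defines a Martin-Löf test, which gives (c). If the measure of `P` is computable, the
probability of late hits is effectively controlled (`coinMeasure_hitsEver_diff_le`), and the test is
a Schnorr test, which gives (b). If `P` is clopen, each `hitSet σ (f n)` is clopen, and being hit at
every `n ≥ 1` is a null `Π⁰₁` condition, which gives (a). -/

section ComputabilityTools

/-! ### Computability: bounded sums and quantifiers, inverses, enumerations. -/

variable {α β σ : Type*} [Primcodable α] [Primcodable β] [Primcodable σ]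

theorem Computable.nat_add {f g : α → ℕ} (hf : Computable f) (hg : Computable g) :
    Computable fun a => f a + g a :=
  Primrec.nat_add.to_comp.comp hf hg

theorem Computable.nat_mul {f g : α → ℕ} (hf : Computable f) (hg : Computable g) :
    Computable fun a => f a * g a :=
  Primrec.nat_mul.to_comp.comp hf hg

theorem Computable.nat_div {f g : α → ℕ} (hf : Computable f) (hg : Computable g) :
    Computable fun a => f a / g a :=
  Primrec.nat_div.to_comp.comp hf hg

/-- The recursor, for step functions given in curried form. -/
theorem Computable.nat_rec_curried {n : α → ℕ} {g : α → σ} {h : α → ℕ → σ → σ}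
    (hn : Computable n) (hg : Computable g)
    (hh : Computable fun p : α × ℕ × σ => h p.1 p.2.1 p.2.2) :
    Computable fun a => (Nat.rec (g a) (h a) (n a) : σ) :=
  Computable.nat_rec (h := fun a p => h a p.1 p.2) hn hg hh.to₂

theorem Computable.two_pow {f : α → ℕ} (hf : Computable f) : Computable fun a => 2 ^ f a :=
  (Computable.nat_rec_curried (h := fun _ _ s => s * 2) hf (Computable.const 1)
    (Computable.nat_mul (Computable.snd.comp Computable.snd) (Computable.const 2))).of_eq fun a => by
      induction f a with
      | zero => rfl
      | succ n ih => simp only [pow_succ, ← ih]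

theorem Computable.sum_range {n : α → ℕ} {h : α → ℕ → ℕ} (hn : Computable n)
    (hh : Computable fun p : α × ℕ => h p.1 p.2) :
    Computable fun a => ∑ x ∈ Finset.range (n a), h a x :=
  (Computable.nat_rec_curried (h := fun a x s => s + h a x) hn (Computable.const 0)
    (Computable.nat_add (Computable.snd.comp Computable.snd)
      (hh.comp (Computable.pair Computable.fst
        (Computable.fst.comp Computable.snd))))).of_eq fun a => by
      induction n a with
      | zero => rfl
      | succ n ih => rw [Finset.sum_range_succ, ← ih]

theorem Computable.finset_sum {ι : Type*} (s : Finset ι) {h : ι → α → ℕ}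
    (hh : ∀ i, Computable (h i)) : Computable fun a => ∑ i ∈ s, h i a := by
  classical
  induction s using Finset.induction_on with
  | empty => simpa using Computable.const 0
  | insert i s hi ih => simpa [Finset.sum_insert hi] using (hh i).nat_add ih

theorem Computable.ite_of_pred {p : α → Prop} [DecidablePred p] {f g : α → σ}
    (hp : ComputablePred p) (hf : Computable f) (hg : Computable g) :
    Computable fun a => if p a then f a else g a :=
  (hp.decide.cond hf hg).of_eq fun a => by by_cases h : p a <;> simp [h]

theorem ComputablePred.comp {p : β → Prop} {f : α → β} (hp : ComputablePred p)
    (hf : Computable f) : ComputablePred fun a => p (f a) := by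
  classical
  exact Computable.computablePred (hp.decide.comp hf)

theorem ComputablePred.and {p q : α → Prop} (hp : ComputablePred p) (hq : ComputablePred q) :
    ComputablePred fun a => p a ∧ q a := by
  classical
  exact Computable.computablePred
    ((Primrec.and.to_comp.comp hp.decide hq.decide).of_eq fun a => by simp)

theorem ComputablePred.eq {f g : α → σ} (hf : Computable f) (hg : Computable g) :
    ComputablePred fun a => f a = g a :=
  (PrimrecPred.computablePred (p := fun q : σ × σ => q.1 = q.2) Primrec.eq).comp (hf.pair hg)

theorem ComputablePred.nat_le {f g : α → ℕ} (hf : Computable f) (hg : Computable g) :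
    ComputablePred fun a => f a ≤ g a :=
  (PrimrecPred.computablePred (p := fun q : ℕ × ℕ => q.1 ≤ q.2) Primrec.nat_le).comp (hf.pair hg)

theorem ComputablePred.nat_lt {f g : α → ℕ} (hf : Computable f) (hg : Computable g) :
    ComputablePred fun a => f a < g a :=
  (PrimrecPred.computablePred (p := fun q : ℕ × ℕ => q.1 < q.2) Primrec.nat_lt).comp (hf.pair hg)

/-- Bounded search reduces to arithmetic: a witness exists iff the sum of the 0/1 indicators is
positive. -/
theorem ComputablePred.exists_lt {n : α → ℕ} {p : α → ℕ → Prop} (hn : Computable n)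
    (hp : ComputablePred fun q : α × ℕ => p q.1 q.2) :
    ComputablePred fun a => ∃ x < n a, p a x := by
  classical
  have h := ComputablePred.nat_lt (Computable.const 0) (Computable.sum_range hn
    (h := fun a x => if p a x then 1 else 0)
    (Computable.ite_of_pred hp (Computable.const 1) (Computable.const 0)))
  refine h.of_eq fun a => ?_
  rw [Finset.sum_pos_iff]
  constructor
  · rintro ⟨x, hx, h⟩
    refine ⟨x, Finset.mem_range.1 hx, ?_⟩
    by_contra hc
    simp [hc] at h
  · rintro ⟨x, hx, h⟩
    exact ⟨x, Finset.mem_range.2 hx, by simp [h]⟩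

theorem ComputablePred.forall_lt {n : α → ℕ} {p : α → ℕ → Prop} (hn : Computable n)
    (hp : ComputablePred fun q : α × ℕ => p q.1 q.2) :
    ComputablePred fun a => ∀ x < n a, p a x :=
  (ComputablePred.exists_lt (p := fun a x => ¬p a x) hn hp.not).not.of_eq fun a => by simp

theorem ComputablePred.exists_fintype {ι : Type*} [Finite ι] {p : ι → α → Prop}
    (hp : ∀ i, ComputablePred (p i)) : ComputablePred fun a => ∃ i, p i a := by
  classical
  have := Fintype.ofFinite ι
  have h := ComputablePred.nat_lt (Computable.const 0) (Computable.finset_sum Finset.univ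
    (h := fun i a => if p i a then 1 else 0)
    fun i => Computable.ite_of_pred (hp i) (Computable.const 1) (Computable.const 0))
  refine h.of_eq fun a => ?_
  rw [Finset.sum_pos_iff]
  constructor
  · rintro ⟨i, -, h⟩
    refine ⟨i, ?_⟩
    by_contra hc
    simp [hc] at h
  · rintro ⟨i, h⟩
    exact ⟨i, Finset.mem_univ i, by simp [h]⟩

theorem ComputablePred.forall_fintype {ι : Type*} [Finite ι] {p : ι → α → Prop}
    (hp : ∀ i, ComputablePred (p i)) : ComputablePred fun a => ∀ i, p i a :=
  (ComputablePred.exists_fintype fun i => (hp i).not).not.of_eq fun a => by simp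

/-- The inverse of a computable bijection onto the natural numbers is computable. -/
theorem Computable.equiv_symm [Inhabited α] (e : α ≃ ℕ) (he : Computable e) :
    Computable e.symm := by
  classical
  have hP : ComputablePred fun p : ℕ × ℕ =>
      (Encodable.decode (α := α) p.2).map e = some p.1 :=
    ComputablePred.eq
      (Computable.option_map (Computable.decode.comp Computable.snd)
        (he.comp Computable.snd).to₂)
      (Computable.option_some.comp Computable.fst)
  have hex : ∀ x : ℕ, ∃ c : ℕ, (Encodable.decode (α := α) c).map e = some x := fun x =>
    ⟨Encodable.encode (e.symm x), by simp⟩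
  -- Unbounded search runs over codes in `ℕ`; since a code is always found, the default value below
  -- is never used.
  have hf := Computable.find (P := fun x c : ℕ =>
    (Encodable.decode (α := α) c).map e = some x) hP hex
  refine (Computable.option_getD (Computable.decode.comp hf)
    (Computable.const (default : α))).of_eq fun x => ?_
  obtain ⟨u, hu, hx⟩ := Option.map_eq_some_iff.1 (Nat.find_spec (hex x))
  rw [hu, ← hx, Option.getD_some, Equiv.symm_apply_apply]

/-- A nonempty c.e. set is the range of a computable function. -/
theorem REPred.exists_computable_range {p : α → Prop} (hp : REPred p) {a₀ : α} (h₀ : p a₀) :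
    ∃ f : ℕ → α, Computable f ∧ ∀ a, p a ↔ ∃ n, f n = a := by
  classical
  obtain ⟨c, hc⟩ := Nat.Partrec.Code.exists_code.1 hp
  have hdom : ∀ a, p a ↔ ∃ k, (Nat.Partrec.Code.evaln k c (Encodable.encode a)).isSome := by
    intro a
    have h1 : p a ↔ (c.eval (Encodable.encode a)).Dom := by
      rw [hc]; simp [Part.assert]
    rw [h1, Part.dom_iff_mem]
    simp only [Nat.Partrec.Code.evaln_complete, Option.isSome_iff_exists, Option.mem_def]
    exact exists_comm
  -- `n` codes a pair of a step bound and an input: output the input if the computation has halted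
  -- on it within the bound, and otherwise the known element `a₀`.
  refine ⟨fun n => cond (Nat.Partrec.Code.evaln n.unpair.1 c n.unpair.2).isSome
    ((Encodable.decode n.unpair.2).getD a₀) a₀, ?_, fun a => ⟨fun ha => ?_, ?_⟩⟩
  · have hu : Computable Nat.unpair := Primrec.unpair.to_comp
    have hev := Nat.Partrec.Code.primrec_evaln.to_comp.comp
      (((Computable.fst.comp hu).pair (Computable.const c)).pair (Computable.snd.comp hu))
    exact Computable.cond (Primrec.option_isSome.to_comp.comp hev)
      (Computable.option_getD (Computable.decode.comp (Computable.snd.comp hu))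
        (Computable.const a₀)) (Computable.const a₀)
  · obtain ⟨k, hk⟩ := (hdom a).1 ha
    exact ⟨Nat.pair k (Encodable.encode a), by simp [hk]⟩
  · rintro ⟨n, hn⟩
    dsimp only at hn
    rcases h : (Nat.Partrec.Code.evaln n.unpair.1 c n.unpair.2).isSome with _ | _
    · rw [h] at hn
      exact hn ▸ h₀
    · rw [h, cond_true] at hn
      obtain ⟨x, hx⟩ := Option.isSome_iff_exists.1 h
      have hx' := Nat.Partrec.Code.evaln_sound (Option.mem_def.2 hx)
      rcases hd : (Encodable.decode n.unpair.2 : Option α) with _ | b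
      · rw [hd] at hn
        exact hn ▸ h₀
      · rw [hd, Option.getD_some] at hn
        subst hn
        rw [hc] at hx'
        simp only [hd, Part.coe_some, Part.bind_some, Part.mem_map_iff, Part.mem_assert_iff] at hx'
        exact hx'.choose_spec.1.1

end ComputabilityTools

/-- The infinite sequence extending a string by zeros. -/
def padString (τ : List Bool) : ℕ → Bool := fun i => τ.getD i false

theorem computable_padString : Computable fun p : List Bool × ℕ => padString p.1 p.2 :=
  (Primrec.list_getD false).to_comp

theorem computable_testBit : Computable fun p : ℕ × ℕ => p.1.testBit p.2 := by
  have h : ComputablePred fun p : ℕ × ℕ => p.1 / 2 ^ p.2 % 2 = 1 :=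
    ComputablePred.eq
      (Primrec.nat_mod.to_comp.comp
        (Computable.nat_div Computable.fst (Computable.two_pow Computable.snd))
        (Computable.const 2)) (Computable.const 1)
  refine h.decide.of_eq fun p => ?_
  rw [Nat.testBit_eq_decide_div_mod_eq]

/-! ### The coin measure: independence and counting. -/

section CoinMeasure

open ProbabilityTheory

instance isProbabilityMeasure_coinMeasure (ι : Type) : IsProbabilityMeasure (coinMeasure ι) := by
  unfold coinMeasure; infer_instance

theorem coinMeasure_cylinder {ι : Type} (s : Finset ι) (v : ι → Bool) :
    coinMeasure ι {Y | ∀ x ∈ s, Y x = v x} = (2⁻¹ : ℝ≥0∞) ^ s.card := by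
  have h : {Y : ι → Bool | ∀ x ∈ s, Y x = v x} = Set.pi s fun x => {v x} := by
    ext Y; simp [Set.mem_pi]
  rw [h, coinMeasure, Measure.infinitePi_pi _ (fun _ _ => .of_discrete)]
  simp

/-- Reading off the coordinates listed by an injective map preserves the coin measure. -/
theorem measurePreserving_comp_coinMeasure {ι ι' : Type} {g : ι' → ι}
    (hg : Function.Injective g) :
    MeasurePreserving (fun Y : ι → Bool => fun x => Y (g x)) (coinMeasure ι) (coinMeasure ι') := by
  have hm : Measurable fun Y : ι → Bool => fun x => Y (g x) := by fun_prop
  refine ⟨hm, Measure.eq_infinitePi _ fun s t ht => ?_⟩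
  classical
  rw [Measure.map_apply hm (.pi s.countable_toSet fun i _ => ht i)]
  have h : (fun Y : ι → Bool => fun x => Y (g x)) ⁻¹' (Set.pi s t)
      = Set.pi (s.map ⟨g, hg⟩) (Function.extend g t fun _ => Set.univ) := by
    ext Y
    simp [Set.mem_pi, hg.extend_apply]
  rw [h, coinMeasure, Measure.infinitePi_pi _ (fun _ _ => .of_discrete), Finset.prod_map]
  simp [hg.extend_apply]

/-- Events that depend on disjoint sets of coordinates are independent. -/
theorem coinMeasure_inter_of_dependsOn {ι : Type} {S : Set ι} {A B : Set (ι → Bool)}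
    (hA : MeasurableSet A) (hB : MeasurableSet B)
    (hAS : ∀ Y Y' : ι → Bool, (∀ x ∈ S, Y x = Y' x) → Y ∈ A → Y' ∈ A)
    (hBS : ∀ Y Y' : ι → Bool, (∀ x ∉ S, Y x = Y' x) → Y ∈ B → Y' ∈ B) :
    coinMeasure ι (A ∩ B) = coinMeasure ι A * coinMeasure ι B := by
  classical
  have key : ∀ (S : Set ι) (A : Set (ι → Bool)), MeasurableSet A →
      (∀ Y Y' : ι → Bool, (∀ x ∈ S, Y x = Y' x) → Y ∈ A → Y' ∈ A) →
      MeasurableSet[⨆ x ∈ S, MeasurableSpace.comap (fun Y : ι → Bool => Y x) inferInstance] A := by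
    intro S A hA hAS
    -- Erasing the coordinates outside `S` is measurable for the σ-algebra generated by `S`, and it
    -- does not affect membership in `A`.
    let r : (ι → Bool) → ι → Bool := fun Y x => if x ∈ S then Y x else false
    have hr : Measurable[⨆ x ∈ S, MeasurableSpace.comap (fun Y : ι → Bool => Y x) inferInstance]
        r := by
      refine @measurable_pi_lambda _ _ _ (_) _ _ fun x => ?_
      by_cases hx : x ∈ S
      · simp only [r, hx, if_true]
        refine Measurable.mono (comap_measurable _) ?_ le_rfl
        exact le_iSup₂ (f := fun x (_ : x ∈ S) =>
          MeasurableSpace.comap (fun Y : ι → Bool => Y x) inferInstance) x hx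
      · simp only [r, hx, if_false]
        exact measurable_const
    have : A = r ⁻¹' A := by
      ext Y
      constructor
      · exact hAS _ _ fun x hx => by simp [r, hx]
      · exact hAS _ _ fun x hx => by simp [r, hx]
    rw [this]
    exact hr hA
  have hind : iIndepFun (fun (x : ι) (Y : ι → Bool) => Y x) (coinMeasure ι) :=
    iIndepFun_infinitePi (X := fun _ b => b) fun _ => measurable_id
  exact (Indep_iff _ _ _).1 (indep_iSup_of_disjoint (fun x => (measurable_pi_apply x).comap_le) hind
    (disjoint_compl_right (a := S))) _ _ (key S A hA hAS) (key Sᶜ B hB hBS)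

/-- Such an event is pulled back from a finite discrete space. -/
theorem measurableSet_of_finite_dependence {ι : Type} (s : Finset ι) {A : Set (ι → Bool)}
    (hA : ∀ Y Y' : ι → Bool, (∀ x ∈ s, Y x = Y' x) → Y ∈ A → Y' ∈ A) : MeasurableSet A := by
  classical
  let e : (s → Bool) → ι → Bool := fun v x => if h : x ∈ s then v ⟨x, h⟩ else false
  have : A = (fun (Y : ι → Bool) (x : s) => Y x) ⁻¹' (e ⁻¹' A) := by
    ext Y
    constructor
    · exact hA _ _ fun x hx => by simp [e, hx]
    · exact hA _ _ fun x hx => by simp [e, hx]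
  rw [this]
  exact (by fun_prop : Measurable fun (Y : ι → Bool) (x : s) => Y x) .of_discrete

/-- The blocks read off by maps that are jointly injective on `x < M` are independent. -/
theorem coinMeasure_iInter_blocks {k M : ℕ} {f : Fin k → ℕ → ℕ}
    (hf : ∀ i j, ∀ x < M, ∀ y < M, f i x = f j y → i = j ∧ x = y) {C : Set (ℕ → Bool)}
    (hC : ∀ Y Y' : ℕ → Bool, (∀ x < M, Y x = Y' x) → Y ∈ C → Y' ∈ C) :
    coinMeasure ℕ {Y | ∀ i, (fun x => Y (f i x)) ∈ C} = coinMeasure ℕ C ^ k := by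
  let ext : (Fin M → Bool) → ℕ → Bool := fun v x => if h : x < M then v ⟨x, h⟩ else false
  let C' : Set (Fin M → Bool) := ext ⁻¹' C
  have hC' : ∀ Y, Y ∈ C ↔ (fun x : Fin M => Y x) ∈ C' := fun Y =>
    ⟨hC _ _ fun x hx => by simp [ext, hx], hC _ _ fun x hx => by simp [ext, hx]⟩
  have h1 : coinMeasure ℕ C = coinMeasure (Fin M) C' := by
    rw [← (measurePreserving_comp_coinMeasure Fin.val_injective).measure_preimage
      (MeasurableSet.of_discrete (s := C')).nullMeasurableSet]
    congr 1
    ext Y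
    exact hC' Y
  let g : Fin k × Fin M → ℕ := fun p => f p.1 p.2
  have hg : Function.Injective g := fun p q h => by
    obtain ⟨h1, h2⟩ := hf _ _ _ p.2.2 _ q.2.2 h
    exact Prod.ext h1 (Fin.ext h2)
  -- Currying turns the `k * M` coins read off by `g` into `k` independent blocks of `M` coins.
  have hcur : (coinMeasure (Fin k × Fin M)).map (MeasurableEquiv.curry (Fin k) (Fin M) Bool)
      = Measure.infinitePi fun _ : Fin k => coinMeasure (Fin M) := by
    unfold coinMeasure
    exact Measure.infinitePi_map_curry (fun _ _ => _)
  have h2 : {Y : ℕ → Bool | ∀ i, (fun x => Y (f i x)) ∈ C} =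
      (fun Y : ℕ → Bool => fun p => Y (g p)) ⁻¹' (MeasurableEquiv.curry (Fin k) (Fin M) Bool ⁻¹'
        Set.pi (Finset.univ : Finset (Fin k)) fun _ => C') := by
    ext Y
    simp only [Set.mem_ofPred_eq, hC', Set.mem_preimage, Set.mem_pi, Finset.coe_univ, Set.mem_univ,
      true_imp_iff]
    rfl
  rw [h2, (measurePreserving_comp_coinMeasure hg).measure_preimage
      (MeasurableSet.of_discrete).nullMeasurableSet,
    ← Measure.map_apply (MeasurableEquiv.measurable _) (MeasurableSet.of_discrete), hcur,
    Measure.infinitePi_pi _ (fun _ _ => .of_discrete), h1]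
  simp

/-- An event that depends on the first `L` bits is measured by counting the binary expansions
`c < 2 ^ L` that belong to it. -/
theorem coinMeasure_eq_count {L : ℕ} {p : (ℕ → Bool) → Prop} [DecidablePred p]
    (hp : ∀ Y Y' : ℕ → Bool, (∀ x < L, Y x = Y' x) → p Y → p Y') :
    (coinMeasure ℕ {Y | p Y}).toReal
      = (∑ c ∈ Finset.range (2 ^ L), if p c.testBit then 1 else 0 : ℕ) / 2 ^ L := by
  have h : {Y | p Y} = ⋃ c ∈ (Finset.range (2 ^ L)).filter fun c => p c.testBit,
      {Y : ℕ → Bool | ∀ x ∈ Finset.range L, Y x = c.testBit x} := by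
    ext Y
    simp only [Set.mem_ofPred_eq, Set.mem_iUnion, Finset.mem_filter, Finset.mem_range, exists_prop]
    constructor
    · intro hY
      have hbit : ∀ x < L, (Nat.ofBits fun i : Fin L => Y i).testBit x = Y x := fun x hx =>
        Nat.testBit_ofBits_lt _ _ hx
      exact ⟨Nat.ofBits fun i : Fin L => Y i,
        ⟨Nat.ofBits_lt_two_pow _, hp _ _ (fun x hx => (hbit x hx).symm) hY⟩,
        fun x hx => (hbit x hx).symm⟩
    · rintro ⟨c, ⟨-, hc⟩, hY⟩
      exact hp _ _ (fun x hx => (hY x hx).symm) hc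
  rw [h, measure_biUnion_finset]
  · simp_rw [coinMeasure_cylinder, Finset.card_range]
    rw [Finset.sum_const, ← Finset.card_filter]
    simp [div_eq_mul_inv]
  · intro c hc d hd hne
    refine Set.disjoint_left.2 fun Y hY hY' => hne (Nat.eq_of_testBit_eq fun x => ?_)
    simp only [Finset.coe_filter, Set.mem_ofPred_eq, Finset.mem_range] at hc hd hY hY'
    by_cases hx : x < L
    · rw [← hY x hx, hY' x hx]
    · have hle : 2 ^ L ≤ 2 ^ x := Nat.pow_le_pow_right two_pos (not_lt.1 hx)
      rw [Nat.testBit_lt_two_pow (hc.1.trans_le hle), Nat.testBit_lt_two_pow (hd.1.trans_le hle)]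
  · exact fun c _ => measurableSet_of_finite_dependence (Finset.range L) fun Y Y' hYY hY x hx =>
      (hYY x hx).symm.trans (hY x hx)

end CoinMeasure

/-! ### Hits, their successive counting, and the geometric bound. -/

section Hits

variable {k : ℕ}

theorem isInitialSegment_iff_padString {τ : List Bool} {Y : ℕ → Bool} :
    IsInitialSegment τ Y ↔ ∀ x < τ.length, Y x = padString τ x :=
  forall₂_congr fun x hx => by simp [padString, hx]

/-- By stage `L`, one of the first `L` strings of the enumeration `σ` is found, below position
`L`, along one of the subsequences of `Y` read off by the maps `h i`. -/
def Hits (σ : ℕ → List Bool) (h : Fin k → ℕ → ℕ) (Y : ℕ → Bool) (L : ℕ) : Prop :=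
  ∃ s < L, ∃ i, ∀ x < (σ s).length, h i x < L ∧ Y (h i x) = padString (σ s) x

/-- The sequences that are hit at some stage. -/
def hitSet (σ : ℕ → List Bool) (h : Fin k → ℕ → ℕ) : Set (ℕ → Bool) :=
  {Y | ∃ L, Hits σ h Y L}

/-- The number of hits up to stage `L` and the stage of the last one, where after a hit at stage
`M` the maps `f (g M)` are used to look for the next one. -/
noncomputable def hitState (σ : ℕ → List Bool) (f : ℕ → Fin k → ℕ → ℕ) (g : ℕ → ℕ)
    (Y : ℕ → Bool) : ℕ → ℕ × ℕ
  | 0 => (0, 0)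
  | L + 1 => open Classical in
    if Hits σ (f (g (hitState σ f g Y L).2)) Y (L + 1) then
      ((hitState σ f g Y L).1 + 1, L + 1) else hitState σ f g Y L

/-- The sequences with at least `r` hits up to stage `L`. -/
def hitsBy (σ : ℕ → List Bool) (f : ℕ → Fin k → ℕ → ℕ) (g : ℕ → ℕ) (r L : ℕ) : Set (ℕ → Bool) :=
  {Y | r ≤ (hitState σ f g Y L).1}

/-- The sequences with at least `r` hits. -/
def hitsEver (σ : ℕ → List Bool) (f : ℕ → Fin k → ℕ → ℕ) (g : ℕ → ℕ) (r : ℕ) : Set (ℕ → Bool) :=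
  ⋃ L, hitsBy σ f g r L

/-- The union of the cylinders given by the first `t` strings. -/
def cylindersBelow (σ : ℕ → List Bool) (t : ℕ) : Set (ℕ → Bool) :=
  {Y | ∃ s < t, IsInitialSegment (σ s) Y}

theorem cylindersBelow_mono (σ : ℕ → List Bool) : Monotone (cylindersBelow σ) :=
  fun _ _ h _ ⟨s, hs, hY⟩ => ⟨s, hs.trans_le h, hY⟩

theorem iUnion_cylindersBelow (σ : ℕ → List Bool) :
    ⋃ t, cylindersBelow σ t = openClass (Set.range σ) := by
  ext Y
  simp only [cylindersBelow, openClass, Set.mem_iUnion, Set.mem_ofPred_eq, Set.exists_range_iff]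
  exact ⟨fun ⟨_, s, _, h⟩ => ⟨s, h⟩, fun ⟨s, h⟩ => ⟨s + 1, s, s.lt_succ_self, h⟩⟩

/-- The sum of the lengths serves as a crude bound for each single length. -/
theorem cylindersBelow_congr {σ : ℕ → List Bool} {t : ℕ} {Y Y' : ℕ → Bool}
    (h : ∀ x < ∑ s ∈ Finset.range t, (σ s).length, Y x = Y' x) (hY : Y ∈ cylindersBelow σ t) :
    Y' ∈ cylindersBelow σ t := by
  obtain ⟨s, hs, hY⟩ := hY
  refine ⟨s, hs, fun x hx => ?_⟩
  rw [← h x (hx.trans_le (Finset.single_le_sum (f := fun s => (σ s).length)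
    (fun _ _ => Nat.zero_le _) (Finset.mem_range.2 hs)))]
  exact hY x hx

theorem measurableSet_cylindersBelow (σ : ℕ → List Bool) (t : ℕ) :
    MeasurableSet (cylindersBelow σ t) :=
  measurableSet_of_finite_dependence (Finset.range (∑ s ∈ Finset.range t, (σ s).length))
    fun _ _ h => cylindersBelow_congr fun x hx => h x (Finset.mem_range.2 hx)

theorem measurableSet_openClass_range (σ : ℕ → List Bool) :
    MeasurableSet (openClass (Set.range σ)) := by
  rw [← iUnion_cylindersBelow]
  exact .iUnion (measurableSet_cylindersBelow σ)

variable {σ : ℕ → List Bool} {h : Fin k → ℕ → ℕ} {f : ℕ → Fin k → ℕ → ℕ} {g : ℕ → ℕ}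
  {Y Y' : ℕ → Bool} {L L' M r : ℕ}

theorem Hits.mono (hL : L ≤ L') : Hits σ h Y L → Hits σ h Y L' :=
  fun ⟨s, hs, i, hi⟩ => ⟨s, hs.trans_le hL, i, fun x hx => ⟨(hi x hx).1.trans_le hL, (hi x hx).2⟩⟩

/-- `Hits` demands that the positions read be below `L`, so a stage-`L` hit is decided by the first
`L` bits. -/
theorem Hits.congr (hY : ∀ x < L, Y x = Y' x) : Hits σ h Y L → Hits σ h Y' L :=
  fun ⟨s, hs, i, hi⟩ => ⟨s, hs, i, fun x hx =>
    ⟨(hi x hx).1, (hY _ (hi x hx).1).symm.trans (hi x hx).2⟩⟩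

theorem hits_congr (hY : ∀ x < L, Y x = Y' x) : Hits σ h Y L ↔ Hits σ h Y' L :=
  ⟨Hits.congr hY, Hits.congr fun x hx => (hY x hx).symm⟩

theorem hits_of_cylindersBelow {t : ℕ} {i : Fin k} (ht : t ≤ L)
    (hL : ∀ s < t, ∀ x < (σ s).length, h i x < L)
    (hY : (fun x => Y (h i x)) ∈ cylindersBelow σ t) : Hits σ h Y L := by
  obtain ⟨s, hs, hi⟩ := hY
  exact ⟨s, hs.trans_le ht, i, fun x hx =>
    ⟨hL s hs x hx, isInitialSegment_iff_padString.1 hi x hx⟩⟩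

theorem mem_hitSet_iff :
    Y ∈ hitSet σ h ↔ ∃ i, (fun x => Y (h i x)) ∈ openClass (Set.range σ) := by
  constructor
  · rintro ⟨L, s, -, i, hi⟩
    exact ⟨i, σ s, ⟨s, rfl⟩, isInitialSegment_iff_padString.2 fun x hx => (hi x hx).2⟩
  · rintro ⟨i, _, ⟨s, rfl⟩, hi⟩
    refine ⟨s + 1 + ∑ x ∈ Finset.range (σ s).length, (h i x + 1), s, by omega, i, fun x hx =>
      ⟨?_, isInitialSegment_iff_padString.1 hi x hx⟩⟩
    have := Finset.single_le_sum (f := fun x => h i x + 1) (fun _ _ => Nat.zero_le _)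
      (Finset.mem_range.2 hx)
    omega

theorem hitSet_eq_iUnion :
    hitSet σ h = ⋃ i, (fun (Y : ℕ → Bool) x => Y (h i x)) ⁻¹' openClass (Set.range σ) := by
  ext Y
  simp only [mem_hitSet_iff, Set.mem_iUnion, Set.mem_preimage]

theorem measurableSet_hitSet : MeasurableSet (hitSet σ h) := by
  rw [hitSet_eq_iUnion]
  exact .iUnion fun i => (by fun_prop : Measurable fun (Y : ℕ → Bool) x => Y (h i x))
    (measurableSet_openClass_range σ)

open Classical in
theorem hitState_succ : hitState σ f g Y (L + 1) =
    if Hits σ (f (g (hitState σ f g Y L).2)) Y (L + 1) then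
      ((hitState σ f g Y L).1 + 1, L + 1) else hitState σ f g Y L := rfl

theorem hitState_congr (hY : ∀ x < L, Y x = Y' x) :
    hitState σ f g Y L = hitState σ f g Y' L := by
  induction L with
  | zero => rfl
  | succ L ih =>
    rw [hitState_succ, hitState_succ, ih fun x hx => hY x (hx.trans L.lt_succ_self)]
    classical exact if_congr (hits_congr hY) rfl rfl

theorem hitState_mono : Monotone fun L => (hitState σ f g Y L).1 := by
  refine monotone_nat_of_le_succ fun L => ?_
  rw [hitState_succ]
  split_ifs
  · exact Nat.le_succ _
  · exact le_rfl

/-- The count grows by at most one per stage, so it takes the value `r`. The state is `(r, M)` at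
stage `M` itself exactly when the `r`-th hit occurs at `M`, where the start counts as hit number
zero. -/
theorem exists_hitState_eq (hr : r ≤ (hitState σ f g Y L).1) :
    ∃ M ≤ L, hitState σ f g Y M = (r, M) := by
  induction L with
  | zero => exact ⟨0, le_rfl, by rw [Nat.le_zero.1 hr]; rfl⟩
  | succ L ih =>
    by_cases hrL : r ≤ (hitState σ f g Y L).1
    · obtain ⟨M, hM, h⟩ := ih hrL
      exact ⟨M, hM.trans L.le_succ, h⟩
    · refine ⟨L + 1, le_rfl, ?_⟩
      rw [hitState_succ] at hr ⊢
      split_ifs at hr ⊢ with hh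
      · exact Prod.ext (by simp only at hr ⊢; omega) rfl
      · exact absurd hr hrL

theorem hitState_of_le (hM : hitState σ f g Y M = (r, M)) (hL : M ≤ L) :
    hitState σ f g Y L = (r, M) ∨ r + 1 ≤ (hitState σ f g Y L).1 := by
  induction L, hL using Nat.le_induction with
  | base => exact .inl hM
  | succ L hL ih =>
    rcases ih with ih | ih
    · rw [hitState_succ]
      split_ifs
      · exact .inr (by rw [ih])
      · exact .inl ih
    · exact .inr (ih.trans (hitState_mono L.le_succ))

theorem hitState_time_unique (hM : hitState σ f g Y M = (r, M))
    (hM' : hitState σ f g Y L = (r, L)) : M = L := by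
  wlog h : M ≤ L generalizing M L
  · exact (this hM' hM (by omega)).symm
  rcases hitState_of_le hM h with h | h
  · rw [hM'] at h
    exact (Prod.ext_iff.1 h).2.symm
  · rw [hM'] at h
    exact absurd h (by simp)

/-- Until the next hit the maps stay frozen at `f (g M)`, and `Hits` is monotone in the stage; so
the counter has moved by stage `L` iff the frozen search succeeds by then. -/
theorem succ_le_hitState_iff (hM : hitState σ f g Y M = (r, M)) (hL : M < L) :
    r + 1 ≤ (hitState σ f g Y L).1 ↔ Hits σ (f (g M)) Y L := by
  have key : ∀ L, M ≤ L → ¬Hits σ (f (g M)) Y L → hitState σ f g Y L = (r, M) := by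
    intro L hL
    induction L, hL using Nat.le_induction with
    | base => exact fun _ => hM
    | succ L hL ih =>
      intro hn
      have := ih fun hc => hn (hc.mono L.le_succ)
      rw [hitState_succ, this, if_neg hn]
  constructor
  · intro hr
    by_contra hn
    rw [key L hL.le hn] at hr
    exact absurd hr (by simp)
  · intro hh
    obtain ⟨L, rfl⟩ := Nat.exists_eq_add_one_of_ne_zero (Nat.ne_zero_of_lt hL)
    rcases hitState_of_le hM (Nat.le_of_lt_succ hL) with h | h
    · rw [hitState_succ, h, if_pos hh]
    · exact h.trans (hitState_mono L.le_succ)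

theorem mem_hitsEver_iff : Y ∈ hitsEver σ f g r ↔ ∃ M, hitState σ f g Y M = (r, M) := by
  simp only [hitsEver, hitsBy, Set.mem_iUnion, Set.mem_ofPred_eq]
  constructor
  · rintro ⟨L, hL⟩
    obtain ⟨M, -, hM⟩ := exists_hitState_eq hL
    exact ⟨M, hM⟩
  · rintro ⟨M, hM⟩
    exact ⟨M, by rw [hM]⟩

theorem hitsEver_succ_subset :
    hitsEver σ f g (r + 1) ⊆ ⋃ M, {Y | hitState σ f g Y M = (r, M)} ∩ hitSet σ (f (g M)) := by
  intro Y hY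
  obtain ⟨L, hL⟩ := Set.mem_iUnion.1 hY
  obtain ⟨M, hML, hM⟩ := exists_hitState_eq ((Nat.le_succ r).trans hL)
  have hlt : M < L := by
    refine lt_of_le_of_ne hML ?_
    rintro rfl
    have : r + 1 ≤ (hitState σ f g Y M).1 := hL
    rw [hM] at this
    exact absurd this (by simp)
  exact Set.mem_iUnion.2 ⟨M, hM, L, (succ_le_hitState_iff hM hlt).1 hL⟩

/-- If every search succeeds, there are infinitely many hits. -/
theorem mem_hitsEver_of_forall (hY : ∀ M, Y ∈ hitSet σ (f (g M))) (r : ℕ) :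
    Y ∈ hitsEver σ f g r := by
  induction r with
  | zero => exact Set.mem_iUnion.2 ⟨0, Nat.zero_le _⟩
  | succ r ih =>
    obtain ⟨M, hM⟩ := mem_hitsEver_iff.1 ih
    obtain ⟨L, hL⟩ := hY M
    exact Set.mem_iUnion.2 ⟨L + (M + 1), (succ_le_hitState_iff hM (by omega)).2
      (hL.mono (by omega))⟩

theorem measurableSet_hitState (p : ℕ × ℕ → Prop) :
    MeasurableSet {Y | p (hitState σ f g Y L)} :=
  measurableSet_of_finite_dependence (Finset.range L) fun Y Y' h hY => by
    rwa [Set.mem_ofPred_eq, ← hitState_congr fun x hx => h x (Finset.mem_range.2 hx)]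

/-- If each search looks only at new coordinates and succeeds with probability at most `q`, then
`r` hits have probability at most `q ^ r`. -/
theorem coinMeasure_hitsEver_le {q : ℝ≥0∞} (hnew : ∀ M i x, M ≤ f (g M) i x)
    (hq : ∀ M, coinMeasure ℕ (hitSet σ (f (g M))) ≤ q) (r : ℕ) :
    coinMeasure ℕ (hitsEver σ f g r) ≤ q ^ r := by
  induction r with
  | zero => simpa using prob_le_one
  | succ r ih =>
    -- Partition according to the stage `M` of the `r`-th hit.
    have hE : hitsEver σ f g r = ⋃ M, {Y | hitState σ f g Y M = (r, M)} := by
      ext Y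
      simp [mem_hitsEver_iff]
    have hdisj : Pairwise (Function.onFun Disjoint fun M => {Y | hitState σ f g Y M = (r, M)}) :=
      fun M M' hne => Set.disjoint_left.2 fun Y hY hY' => hne (hitState_time_unique hY hY')
    calc coinMeasure ℕ (hitsEver σ f g (r + 1))
        ≤ ∑' M, coinMeasure ℕ ({Y | hitState σ f g Y M = (r, M)} ∩ hitSet σ (f (g M))) :=
          (measure_mono hitsEver_succ_subset).trans (measure_iUnion_le _)
      _ ≤ ∑' M, coinMeasure ℕ {Y | hitState σ f g Y M = (r, M)} * q := by
          refine ENNReal.tsum_le_tsum fun M => ?_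
          -- The `r`-th hit at stage `M` is determined by the bits below `M`, and the next search
          -- reads only bits from `M` on.
          rw [coinMeasure_inter_of_dependsOn (S := Set.Iio M)
            (measurableSet_hitState fun p => p = (r, M)) measurableSet_hitSet
            (fun Y Y' h hY => by rwa [Set.mem_ofPred_eq, ← hitState_congr h])
            (fun Y Y' h hY => ?_)]
          · gcongr
            exact hq M
          · rw [mem_hitSet_iff] at hY ⊢
            obtain ⟨i, hi⟩ := hY
            refine ⟨i, ?_⟩
            rwa [← funext fun x => h (f (g M) i x) (by simpa using hnew M i x)]
      _ = coinMeasure ℕ (hitsEver σ f g r) * q := by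
          rw [ENNReal.tsum_mul_right, hE, measure_iUnion hdisj fun M =>
            measurableSet_hitState fun p => p = (r, M)]
      _ ≤ q ^ (r + 1) := by
          rw [pow_succ]
          gcongr

/-! ### Computability of the hit counter. -/

section Computability

variable {α : Type*} [Primcodable α]

theorem computablePred_hits (hσ : Computable σ)
    (hf : ∀ i, Computable fun p : ℕ × ℕ => f p.1 i p.2) {X : α → ℕ → Bool}
    (hX : Computable fun p : α × ℕ => X p.1 p.2) {n l : α → ℕ} (hn : Computable n)
    (hl : Computable l) : ComputablePred fun a => Hits σ (f (n a)) (X a) (l a) := by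
  refine ComputablePred.exists_lt (p := fun a s => ∃ i, ∀ x < (σ s).length,
    f (n a) i x < l a ∧ X a (f (n a) i x) = padString (σ s) x) hl ?_
  refine ComputablePred.exists_fintype fun i => ?_
  have hs : Computable fun q : α × ℕ => σ q.2 := hσ.comp Computable.snd
  refine ComputablePred.forall_lt (p := fun (q : α × ℕ) x =>
    f (n q.1) i x < l q.1 ∧ X q.1 (f (n q.1) i x) = padString (σ q.2) x)
    (Computable.list_length.comp hs) ?_
  have ha : Computable fun c : (α × ℕ) × ℕ => c.1.1 := Computable.fst.comp Computable.fst
  have hfx : Computable fun c : (α × ℕ) × ℕ => f (n c.1.1) i c.2 :=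
    (hf i).comp ((hn.comp ha).pair Computable.snd)
  exact (ComputablePred.nat_lt hfx (hl.comp ha)).and
    (ComputablePred.eq (hX.comp (ha.pair hfx))
      (computable_padString.comp ((hs.comp Computable.fst).pair Computable.snd)))

theorem computable_hitState (hσ : Computable σ)
    (hf : ∀ i, Computable fun p : ℕ × ℕ => f p.1 i p.2) (hg : Computable g) {X : α → ℕ → Bool}
    (hX : Computable fun p : α × ℕ => X p.1 p.2) {l : α → ℕ} (hl : Computable l) :
    Computable fun a => hitState σ f g (X a) (l a) := by
  classical
  have hs : Computable fun p : α × ℕ × ℕ × ℕ => p.2.2 := Computable.snd.comp Computable.snd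
  have hL : Computable fun p : α × ℕ × ℕ × ℕ => p.2.1 + 1 :=
    Computable.succ.comp (Computable.fst.comp Computable.snd)
  have hh : ComputablePred fun p : α × ℕ × ℕ × ℕ =>
      Hits σ (f (g p.2.2.2)) (X p.1) (p.2.1 + 1) :=
    computablePred_hits (X := fun p : α × ℕ × ℕ × ℕ => X p.1) hσ hf
      (hX.comp ((Computable.fst.comp Computable.fst).pair Computable.snd))
      (hg.comp (Computable.snd.comp hs)) hL
  have hstep : Computable fun p : α × ℕ × ℕ × ℕ =>
      if Hits σ (f (g p.2.2.2)) (X p.1) (p.2.1 + 1) then (p.2.2.1 + 1, p.2.1 + 1) else p.2.2 :=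
    Computable.ite_of_pred hh ((Computable.succ.comp (Computable.fst.comp hs)).pair hL) hs
  refine (Computable.nat_rec_curried (h := fun a L s =>
    if Hits σ (f (g s.2)) (X a) (L + 1) then (s.1 + 1, L + 1) else s) hl
    (Computable.const (0, 0)) hstep).of_eq fun a => ?_
  induction l a with
  | zero => rfl
  | succ L ih =>
    rw [hitState_succ, ← ih]

end Computability

end Hits

/-! ### Probability of a hit, and effective control of late hits. -/

section Bounds

variable {k : ℕ} {σ : ℕ → List Bool} {f : ℕ → Fin k → ℕ → ℕ} {g : ℕ → ℕ}

theorem computablePred_forall_eq_padString {α : Type*} [Primcodable α] {X : α → ℕ → Bool}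
    (hX : Computable fun p : α × ℕ => X p.1 p.2) {τ : α → List Bool} (hτ : Computable τ) :
    ComputablePred fun a => ∀ x < (τ a).length, X a x = padString (τ a) x :=
  ComputablePred.forall_lt (p := fun a x => X a x = padString (τ a) x)
    (Computable.list_length.comp hτ) (ComputablePred.eq hX
      (computable_padString.comp ((hτ.comp Computable.fst).pair Computable.snd)))

theorem cylindersBelow_subset_openClass (σ : ℕ → List Bool) (t : ℕ) :
    cylindersBelow σ t ⊆ openClass (Set.range σ) := by
  rw [← iUnion_cylindersBelow]
  exact Set.subset_iUnion _ t

theorem exists_coinMeasure_diff_cylindersBelow_lt (σ : ℕ → List Bool) {ε : ℝ} (hε : 0 < ε) :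
    ∃ t, (coinMeasure ℕ).real (openClass (Set.range σ) \ cylindersBelow σ t) < ε := by
  have h := tendsto_measure_iInter_atTop (μ := coinMeasure ℕ)
    (s := fun t => openClass (Set.range σ) \ cylindersBelow σ t)
    (fun t => ((measurableSet_openClass_range σ).diff
      (measurableSet_cylindersBelow σ t)).nullMeasurableSet)
    (fun _ _ h => Set.sdiff_subset_sdiff_right (cylindersBelow_mono σ h)) ⟨0, measure_ne_top _ _⟩
  rw [← Set.sdiff_iUnion, iUnion_cylindersBelow, Set.sdiff_self, measure_empty] at h
  have h' := (ENNReal.tendsto_toReal ENNReal.zero_ne_top).comp h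
  exact ((tendsto_order.1 h').2 ε hε).exists

/-- If the complement of the open class has positive measure and the maps `f n i` have disjoint
ranges in the limit, then hits have probability bounded away from one for large `n`. -/
theorem exists_coinMeasure_hitSet_le (hinj : ∀ n i, Function.Injective (f n i))
    (hsep : ∀ M, ∃ N, ∀ n ≥ N, ∀ i j, ∀ x < M, ∀ y < M, f n i x = f n j y → i = j ∧ x = y)
    (hpos : 0 < coinMeasure ℕ (openClass (Set.range σ))ᶜ) :
    ∃ N, ∃ q < 1, ∀ n ≥ N, coinMeasure ℕ (hitSet σ (f n)) ≤ q := by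
  set μ := coinMeasure ℕ
  set V := openClass (Set.range σ)
  have hp : 0 < μ.real Vᶜ := ENNReal.toReal_pos hpos.ne' (measure_ne_top _ _)
  set p := μ.real Vᶜ
  have hpk : 0 < p ^ k := pow_pos hp k
  -- All `k` blocks avoid the first `t` cylinders with probability at least `p ^ k`; with this error
  -- the `k` remainders of `V` cost at most half of that.
  have hε : 0 < p ^ k / (2 * (k + 1)) := by positivity
  obtain ⟨t, ht⟩ := exists_coinMeasure_diff_cylindersBelow_lt σ hε
  obtain ⟨N, hN⟩ := hsep (∑ s ∈ Finset.range t, (σ s).length)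
  refine ⟨N, ENNReal.ofReal (1 - p ^ k / 2), ?_, fun n hn => ?_⟩
  · rw [← ENNReal.ofReal_one]
    exact (ENNReal.ofReal_lt_ofReal_iff one_pos).2 (by linarith)
  have hVt := measurableSet_cylindersBelow σ t
  have hm : ∀ i, Measurable fun (Y : ℕ → Bool) x => Y (f n i x) := fun i => by fun_prop
  set E := {Y : ℕ → Bool | ∀ i, (fun x => Y (f n i x)) ∈ (cylindersBelow σ t)ᶜ} with hE
  have hEm : MeasurableSet E := by
    have : E = ⋂ i, (fun (Y : ℕ → Bool) x => Y (f n i x)) ⁻¹' (cylindersBelow σ t)ᶜ := by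
      ext Y; simp [hE]
    rw [this]
    exact .iInter fun i => hm i hVt.compl
  have hEμ : p ^ k ≤ μ.real E := by
    have h1 : μ E = μ (cylindersBelow σ t)ᶜ ^ k :=
      coinMeasure_iInter_blocks (hN n hn) fun Y Y' h hY hY' =>
        hY (cylindersBelow_congr (fun x hx => (h x hx).symm) hY')
    rw [measureReal_def, h1, ENNReal.toReal_pow]
    exact pow_le_pow_left₀ hp.le
      (measureReal_mono (Set.compl_subset_compl.2 (cylindersBelow_subset_openClass σ t))) k
  -- A hit comes from the first `t` cylinders, against `E`, or from the small remainder of `V` in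
  -- some block.
  have hsub : hitSet σ (f n) ⊆ Eᶜ ∪ ⋃ i, (fun (Y : ℕ → Bool) x => Y (f n i x)) ⁻¹'
      (V \ cylindersBelow σ t) := by
    intro Y hY
    obtain ⟨i, hi⟩ := mem_hitSet_iff.1 hY
    by_cases hc : Y ∈ E
    · exact .inr (Set.mem_iUnion.2 ⟨i, hi, hc i⟩)
    · exact .inl hc
  have hU : μ.real (⋃ i, (fun (Y : ℕ → Bool) x => Y (f n i x)) ⁻¹' (V \ cylindersBelow σ t))
      ≤ k * (p ^ k / (2 * (k + 1))) := by
    refine (measureReal_iUnion_fintype_le _).trans ?_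
    refine (Finset.sum_le_card_nsmul _ _ (p ^ k / (2 * (k + 1))) fun i _ => ?_).trans_eq (by simp)
    rw [measureReal_def, (measurePreserving_comp_coinMeasure (hinj n i)).measure_preimage
      ((measurableSet_openClass_range σ).diff hVt).nullMeasurableSet]
    exact ht.le
  have hk2 : k * (p ^ k / (2 * (k + 1))) ≤ p ^ k / 2 := by
    rw [← mul_div_assoc, div_le_div_iff₀ (by positivity) two_pos]
    nlinarith
  refine (ENNReal.le_ofReal_iff_toReal_le (measure_ne_top _ _) ?_).2 ?_
  · have : p ^ k ≤ 1 := hEμ.trans measureReal_le_one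
    linarith
  · have h2 := (measureReal_mono (μ := μ) hsub).trans (measureReal_union_le _ _)
    rw [probReal_compl_eq_one_sub hEm] at h2
    rw [← measureReal_def]
    linarith

/-- If the complement of the open class has computable measure, then the classes `cylindersBelow σ t`
approximate it with a computable modulus. -/
theorem exists_computable_modulus (hσ : Computable σ)
    (hc : IsComputableReal (coinMeasure ℕ (openClass (Set.range σ))ᶜ).toReal) :
    ∃ v : ℕ → ℕ, Computable v ∧ ∀ n,
      coinMeasure ℕ (openClass (Set.range σ) \ cylindersBelow σ (v n)) ≤ (2⁻¹ : ℝ≥0∞) ^ n := by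
  classical
  obtain ⟨a, b, ha, hb, hab⟩ := hc
  set V := openClass (Set.range σ)
  let l : ℕ → ℕ := fun t => ∑ s ∈ Finset.range t, (σ s).length
  let N : ℕ → ℕ := fun t => ∑ c ∈ Finset.range (2 ^ l t),
    if (∃ s < t, ∀ x < (σ s).length, c.testBit x = padString (σ s) x) then 1 else 0
  have hl : Computable l := Computable.sum_range (h := fun _ s => (σ s).length) Computable.id
    (Computable.list_length.comp (hσ.comp Computable.snd))
  have hcyl : ComputablePred fun p : ℕ × ℕ =>
      ∃ s < p.1, ∀ x < (σ s).length, p.2.testBit x = padString (σ s) x := by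
    refine ComputablePred.exists_lt (p := fun (p : ℕ × ℕ) s => ∀ x < (σ s).length,
      p.2.testBit x = padString (σ s) x) Computable.fst ?_
    have hX : Computable fun q : ((ℕ × ℕ) × ℕ) × ℕ => q.1.1.2.testBit q.2 :=
      computable_testBit.comp (f := fun q : ℕ × ℕ => q.1.testBit q.2)
        (g := fun q : ((ℕ × ℕ) × ℕ) × ℕ => (q.1.1.2, q.2))
        ((Computable.snd.comp (Computable.fst.comp Computable.fst)).pair Computable.snd)
    exact computablePred_forall_eq_padString (X := fun q : (ℕ × ℕ) × ℕ => q.1.2.testBit) hX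
      (hσ.comp Computable.snd)
  have hN : Computable N := Computable.sum_range (h := fun t c =>
      if (∃ s < t, ∀ x < (σ s).length, c.testBit x = padString (σ s) x) then 1 else 0)
      (Computable.two_pow hl)
      (Computable.ite_of_pred hcyl (Computable.const 1) (Computable.const 0))
  have hNμ : ∀ t, (coinMeasure ℕ).real (cylindersBelow σ t) = N t / 2 ^ l t := by
    intro t
    have h1 : cylindersBelow σ t
        = {Y | ∃ s < t, ∀ x < (σ s).length, Y x = padString (σ s) x} := by
      ext Y
      simp only [cylindersBelow, isInitialSegment_iff_padString]
    rw [h1]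
    refine coinMeasure_eq_count (L := l t) fun Y Y' h hY => ?_
    have h2 : Y' ∈ cylindersBelow σ t := cylindersBelow_congr h (by rw [h1]; exact hY)
    rw [h1] at h2
    exact h2
  have hdiff : ∀ t, (coinMeasure ℕ).real (V \ cylindersBelow σ t)
      = 1 - (coinMeasure ℕ).real Vᶜ - N t / 2 ^ l t := by
    intro t
    rw [measureReal_sdiff (cylindersBelow_subset_openClass σ t) (measurableSet_cylindersBelow σ t),
      hNμ, probReal_compl_eq_one_sub (measurableSet_openClass_range σ)]
    ring
  -- Clearing denominators makes the approximate test on `t` a decidable inequality between natural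
  -- numbers.
  have hreal : ∀ j t : ℕ, (2 ^ j + b j) * 2 ^ l t ≤ N t * 2 ^ j + (a j + 2) * 2 ^ l t ↔
      1 - ((a j : ℝ) - b j) / 2 ^ j - N t / 2 ^ l t ≤ 2 * (1 / 2 : ℝ) ^ j := by
    intro j t
    have e : 2 * (1 / 2 : ℝ) ^ j - (1 - ((a j : ℝ) - b j) / 2 ^ j - N t / 2 ^ l t)
        = ((N t * 2 ^ j + (a j + 2) * 2 ^ l t) - (2 ^ j + b j) * 2 ^ l t) / (2 ^ j * 2 ^ l t) := by
      rw [div_pow, one_pow]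
      field_simp
      ring
    rw [← sub_nonneg (b := 1 - ((a j : ℝ) - b j) / 2 ^ j - N t / 2 ^ l t), e,
      le_div_iff₀ (by positivity), zero_mul, sub_nonneg]
    exact_mod_cast Iff.rfl
  -- With `j = n + 2`, a remainder below `2 ^ (-j)` passes the test with tolerance `2 * 2 ^ (-j)`;
  -- conversely, passing bounds the remainder by `3 * 2 ^ (-j)`, which is less than `2 ^ (-n)`.
  have hex : ∀ n, ∃ t, (2 ^ (n + 2) + b (n + 2)) * 2 ^ l t
      ≤ N t * 2 ^ (n + 2) + (a (n + 2) + 2) * 2 ^ l t := by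
    intro n
    obtain ⟨t, ht⟩ := exists_coinMeasure_diff_cylindersBelow_lt σ
      (ε := (1 / 2 : ℝ) ^ (n + 2)) (by positivity)
    refine ⟨t, (hreal _ _).2 ?_⟩
    have h1 := hdiff t
    have h2 := abs_le.1 (hab (n + 2))
    rw [← measureReal_def] at h2
    linarith [h2.2]
  have hfst : Computable fun p : ℕ × ℕ => p.1 + 2 :=
    Computable.nat_add Computable.fst (Computable.const 2)
  have h2l : Computable fun p : ℕ × ℕ => 2 ^ l p.2 := Computable.two_pow (hl.comp Computable.snd)
  refine ⟨_, Computable.find (P := fun n t => (2 ^ (n + 2) + b (n + 2)) * 2 ^ l t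
      ≤ N t * 2 ^ (n + 2) + (a (n + 2) + 2) * 2 ^ l t) (ComputablePred.nat_le
        (((Computable.two_pow hfst).nat_add (hb.comp hfst)).nat_mul h2l)
        (((hN.comp Computable.snd).nat_mul (Computable.two_pow hfst)).nat_add
          (((ha.comp hfst).nat_add (Computable.const 2)).nat_mul h2l))) hex, fun n => ?_⟩
  have h1 := (hreal _ _).1 (Nat.find_spec (hex n))
  have h2 := abs_le.1 (hab (n + 2))
  rw [← measureReal_def] at h2
  have h3 := hdiff (Nat.find (hex n))
  have h4 : (coinMeasure ℕ).real (V \ cylindersBelow σ (Nat.find (hex n))) ≤ (1 / 2 : ℝ) ^ n := by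
    have e : (1 / 2 : ℝ) ^ (n + 2) = (1 / 2 : ℝ) ^ n / 4 := by rw [pow_add]; norm_num; ring
    have : (0 : ℝ) < (1 / 2 : ℝ) ^ n := by positivity
    rw [e] at h1 h2
    linarith [h2.1]
  rw [← ENNReal.ofReal_toReal (measure_ne_top _ _ :
    coinMeasure ℕ (V \ cylindersBelow σ (Nat.find (hex n))) ≠ ∞)]
  refine (ENNReal.ofReal_le_ofReal h4).trans_eq ?_
  rw [ENNReal.ofReal_pow (by norm_num), one_div, ENNReal.ofReal_inv_of_pos two_pos]
  simp

/-- A stage by which every hit that is due to the first `t` strings has been found. -/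
def hitStage (σ : ℕ → List Bool) (h : Fin k → ℕ → ℕ) (t : ℕ) : ℕ :=
  t + ∑ s ∈ Finset.range t, ∑ x ∈ Finset.range (σ s).length, ∑ i, (h i x + 1)

theorem lt_hitStage (h : Fin k → ℕ → ℕ) {t s x : ℕ} (hs : s < t) (hx : x < (σ s).length)
    (i : Fin k) : h i x < hitStage σ h t := by
  have h1 := Finset.single_le_sum (f := fun i => h i x + 1) (fun _ _ => Nat.zero_le _)
    (Finset.mem_univ i)
  have h2 := Finset.single_le_sum (f := fun x => ∑ i, (h i x + 1)) (fun _ _ => Nat.zero_le _)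
    (Finset.mem_range.2 hx)
  have h3 := Finset.single_le_sum
    (f := fun s => ∑ x ∈ Finset.range (σ s).length, ∑ i, (h i x + 1)) (fun _ _ => Nat.zero_le _)
    (Finset.mem_range.2 hs)
  unfold hitStage
  omega

/-- A late hit puts one of the `k` subsequences into `V` but outside the first `t` cylinders;
reading along an injective map preserves measure, so a union bound applies. -/
theorem coinMeasure_hitSet_diff_le {h : Fin k → ℕ → ℕ} (hinj : ∀ i, Function.Injective (h i))
    {t : ℕ} {ε : ℝ≥0∞} (ht : coinMeasure ℕ (openClass (Set.range σ) \ cylindersBelow σ t) ≤ ε) :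
    coinMeasure ℕ {Y | Y ∈ hitSet σ h ∧ ¬Hits σ h Y (hitStage σ h t)} ≤ k * ε := by
  have hsub : {Y | Y ∈ hitSet σ h ∧ ¬Hits σ h Y (hitStage σ h t)} ⊆
      ⋃ i, (fun (Y : ℕ → Bool) x => Y (h i x)) ⁻¹'
        (openClass (Set.range σ) \ cylindersBelow σ t) := by
    rintro Y ⟨hY, hn⟩
    obtain ⟨i, hi⟩ := mem_hitSet_iff.1 hY
    exact Set.mem_iUnion.2 ⟨i, hi, fun hc => hn (hits_of_cylindersBelow (Nat.le_add_right _ _)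
      (fun s hs x hx => lt_hitStage h hs hx i) hc)⟩
  refine (measure_mono hsub).trans ((measure_iUnion_fintype_le _ _).trans ?_)
  refine (Finset.sum_le_card_nsmul _ _ ε fun i _ => ?_).trans_eq (by simp)
  rw [(measurePreserving_comp_coinMeasure (hinj i)).measure_preimage
    ((measurableSet_openClass_range σ).diff (measurableSet_cylindersBelow σ t)).nullMeasurableSet]
  exact ht

/-- Since `a ≤ 2 ^ a`, raising the exponent by `a` absorbs a union bound over `a` events. -/
theorem natCast_mul_two_inv_pow_le {a n : ℕ} :
    (a : ℝ≥0∞) * (2⁻¹ : ℝ≥0∞) ^ (n + a) ≤ (2⁻¹ : ℝ≥0∞) ^ n := by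
  have h : (a : ℝ≥0∞) * (2⁻¹ : ℝ≥0∞) ^ a ≤ 1 := by
    rw [← ENNReal.inv_pow, ← div_eq_mul_inv]
    refine ENNReal.div_le_of_le_mul ?_
    rw [one_mul]
    exact_mod_cast (Nat.lt_two_pow_self).le
  calc (a : ℝ≥0∞) * (2⁻¹ : ℝ≥0∞) ^ (n + a)
      = (2⁻¹ : ℝ≥0∞) ^ n * (a * (2⁻¹ : ℝ≥0∞) ^ a) := by rw [pow_add]; ring
    _ ≤ (2⁻¹ : ℝ≥0∞) ^ n * 1 := by gcongr
    _ = _ := mul_one _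

/-- A stage by which `r` hits have been found, up to a small probability that is controlled
by `j`. -/
def manyHitsStage (σ : ℕ → List Bool) (f : ℕ → Fin k → ℕ → ℕ) (g v : ℕ → ℕ) (j : ℕ) : ℕ → ℕ
  | 0 => 0
  | r + 1 => manyHitsStage σ f g v j r + 1 +
      ∑ M ∈ Finset.range (manyHitsStage σ f g v j r + 1),
        hitStage σ (f (g M)) (v (j + (manyHitsStage σ f g v j r + 1)))

/-- If hit `r + 1` is late, then either hit `r` was late already, or it came at some `M ≤ l` and the
search started there was slow. Each hit thus adds an error of at most `k * 2 ^ (-j)`. -/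
theorem coinMeasure_hitsEver_diff_le (hinj : ∀ n i, Function.Injective (f n i)) {v : ℕ → ℕ}
    (hv : ∀ n,
      coinMeasure ℕ (openClass (Set.range σ) \ cylindersBelow σ (v n)) ≤ (2⁻¹ : ℝ≥0∞) ^ n)
    (j r : ℕ) :
    coinMeasure ℕ (hitsEver σ f g r \ hitsBy σ f g r (manyHitsStage σ f g v j r))
      ≤ r * (k * (2⁻¹ : ℝ≥0∞) ^ j) := by
  induction r with
  | zero =>
    have : hitsBy σ f g 0 (manyHitsStage σ f g v j 0) = Set.univ :=
      Set.eq_univ_of_forall fun Y => Nat.zero_le _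
    simp [this]
  | succ r ih =>
    set l := manyHitsStage σ f g v j r with hl
    set t := v (j + (l + 1))
    have hsub : hitsEver σ f g (r + 1) \ hitsBy σ f g (r + 1) (manyHitsStage σ f g v j (r + 1)) ⊆
        (hitsEver σ f g r \ hitsBy σ f g r l) ∪ ⋃ M ∈ Finset.range (l + 1),
          {Y | Y ∈ hitSet σ (f (g M)) ∧ ¬Hits σ (f (g M)) Y (hitStage σ (f (g M)) t)} := by
      rintro Y ⟨hY, hn⟩
      obtain ⟨M', hM', hhit⟩ := Set.mem_iUnion.1 (hitsEver_succ_subset hY)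
      by_cases hlY : Y ∈ hitsBy σ f g r l
      · right
        obtain ⟨M, hM, hstate⟩ := exists_hitState_eq hlY
        obtain rfl := hitState_time_unique hstate hM'
        have hMl : M ∈ Finset.range (l + 1) := Finset.mem_range.2 (Nat.lt_succ_of_le hM)
        refine Set.mem_iUnion₂.2 ⟨M, hMl, hhit, fun hc => hn ?_⟩
        have hle := Finset.single_le_sum (f := fun M => hitStage σ (f (g M)) t)
          (fun _ _ => Nat.zero_le _) hMl
        have hstage : manyHitsStage σ f g v j (r + 1)
            = l + 1 + ∑ M ∈ Finset.range (l + 1), hitStage σ (f (g M)) t := rfl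
        exact (succ_le_hitState_iff hstate (by omega)).2 (hc.mono (by omega))
      · exact .inl ⟨mem_hitsEver_iff.2 ⟨M', hM'⟩, hlY⟩
    refine (measure_mono hsub).trans ((measure_union_le _ _).trans ?_)
    have h2 : coinMeasure ℕ (⋃ M ∈ Finset.range (l + 1),
        {Y | Y ∈ hitSet σ (f (g M)) ∧ ¬Hits σ (f (g M)) Y (hitStage σ (f (g M)) t)})
        ≤ k * (2⁻¹ : ℝ≥0∞) ^ j := by
      refine (measure_biUnion_finset_le _ _).trans ?_
      refine (Finset.sum_le_card_nsmul _ _ _ fun M _ =>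
        coinMeasure_hitSet_diff_le (hinj (g M)) (hv _)).trans ?_
      -- The summand `l + 1` in the argument of `v` pays for the `l + 1` possible values of `M`.
      rw [Finset.card_range, nsmul_eq_mul, mul_left_comm]
      gcongr
      exact natCast_mul_two_inv_pow_le
    refine (add_le_add ih h2).trans_eq ?_
    push_cast
    ring

theorem computable_hitStage (hσ : Computable σ)
    (hf : ∀ i, Computable fun p : ℕ × ℕ => f p.1 i p.2) :
    Computable fun p : ℕ × ℕ => hitStage σ (f p.1) p.2 := by
  have hτ : Computable fun q : (ℕ × ℕ) × ℕ => (σ q.2).length :=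
    Computable.list_length.comp (hσ.comp Computable.snd)
  have hpair : Computable fun c : ((ℕ × ℕ) × ℕ) × ℕ => (c.1.1.1, c.2) :=
    (Computable.fst.comp (Computable.fst.comp Computable.fst)).pair Computable.snd
  have hfi : ∀ i, Computable fun c : ((ℕ × ℕ) × ℕ) × ℕ => f c.1.1.1 i c.2 + 1 := by
    intro i
    have h := (hf i).comp hpair
    exact Computable.nat_add h (Computable.const 1)
  have hsum : Computable fun q : (ℕ × ℕ) × ℕ =>
      ∑ x ∈ Finset.range (σ q.2).length, ∑ i, (f q.1.1 i x + 1) :=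
    Computable.sum_range (h := fun (q : (ℕ × ℕ) × ℕ) x => ∑ i, (f q.1.1 i x + 1)) hτ
      (Computable.finset_sum Finset.univ hfi)
  have hsum' : Computable fun p : ℕ × ℕ =>
      ∑ s ∈ Finset.range p.2, ∑ x ∈ Finset.range (σ s).length, ∑ i, (f p.1 i x + 1) :=
    Computable.sum_range (h := fun (p : ℕ × ℕ) s =>
      ∑ x ∈ Finset.range (σ s).length, ∑ i, (f p.1 i x + 1)) Computable.snd hsum
  exact Computable.nat_add Computable.snd hsum'

theorem computable_manyHitsStage (hσ : Computable σ)
    (hf : ∀ i, Computable fun p : ℕ × ℕ => f p.1 i p.2) (hg : Computable g) {v : ℕ → ℕ}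
    (hv : Computable v) : Computable fun p : ℕ × ℕ => manyHitsStage σ f g v p.1 p.2 := by
  have hs : Computable fun p : (ℕ × ℕ) × ℕ × ℕ => p.2.2 + 1 :=
    Computable.succ.comp (Computable.snd.comp Computable.snd)
  have hstep : Computable fun p : (ℕ × ℕ) × ℕ × ℕ => p.2.2 + 1 +
      ∑ M ∈ Finset.range (p.2.2 + 1), hitStage σ (f (g M)) (v (p.1.1 + (p.2.2 + 1))) := by
    refine Computable.nat_add hs (Computable.sum_range (h := fun (p : (ℕ × ℕ) × ℕ × ℕ) M =>
      hitStage σ (f (g M)) (v (p.1.1 + (p.2.2 + 1)))) hs ?_)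
    exact (computable_hitStage hσ hf).comp ((hg.comp Computable.snd).pair (hv.comp
      (Computable.nat_add (Computable.fst.comp (Computable.fst.comp Computable.fst))
        (hs.comp Computable.fst))))
  refine (Computable.nat_rec_curried (h := fun (p : ℕ × ℕ) _ s => s + 1 +
    ∑ M ∈ Finset.range (s + 1), hitStage σ (f (g M)) (v (p.1 + (s + 1))))
    Computable.snd (Computable.const 0) hstep).of_eq fun p => ?_
  induction p.2 with
  | zero => rfl
  | succ r ih => rw [manyHitsStage, ← ih]

end Bounds

/-! ### The tests, and recurrence in Cantor space. -/

section Recurrence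

variable {k : ℕ} {σ : ℕ → List Bool} {f : ℕ → Fin k → ℕ → ℕ} {g : ℕ → ℕ}

/-- This makes a `Σ⁰₁` class out of a decidable stage condition: if stage `L` looks only at the
first `L` bits, the prefix of length `L` decides it, and the padding is irrelevant. -/
theorem openClass_setOf_padString {p : (ℕ → Bool) → ℕ → Prop}
    (hcongr : ∀ Y Y' L, (∀ x < L, Y x = Y' x) → p Y L → p Y' L) :
    openClass {τ | p (padString τ) τ.length} = {Y | ∃ L, p Y L} := by
  ext Y
  constructor
  · rintro ⟨τ, hτ, hY⟩
    exact ⟨τ.length, hcongr _ _ _ (fun x hx => (isInitialSegment_iff_padString.1 hY x hx).symm) hτ⟩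
  · rintro ⟨L, hL⟩
    have hlen : (List.ofFn fun i : Fin L => Y i).length = L := List.length_ofFn
    have hpad : ∀ x < L, Y x = padString (List.ofFn fun i : Fin L => Y i) x := fun x hx => by
      simp [padString, hx]
    refine ⟨List.ofFn fun i : Fin L => Y i, ?_, isInitialSegment_iff_padString.2 ?_⟩
    · rw [Set.mem_ofPred_eq, hlen]
      exact hcongr _ _ _ hpad hL
    · rwa [hlen]

theorem computable_hitState_padString (hσ : Computable σ)
    (hf : ∀ i, Computable fun p : ℕ × ℕ => f p.1 i p.2) (hg : Computable g) :
    Computable fun τ : List Bool => hitState σ f g (padString τ) τ.length :=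
  computable_hitState hσ hf hg computable_padString Computable.list_length

/-- The classes of sequences with at least `c * m` hits form a Martin-Löf test. -/
theorem isMLTest_hitsEver (hσ : Computable σ)
    (hf : ∀ i, Computable fun p : ℕ × ℕ => f p.1 i p.2) (hg : Computable g) {c : ℕ}
    (hle : ∀ m, coinMeasure ℕ (hitsEver σ f g (c * m)) ≤ (2⁻¹ : ℝ≥0∞) ^ m) :
    IsMLTest fun m => hitsEver σ f g (c * m) := by
  refine ⟨⟨fun m => {τ | c * m ≤ (hitState σ f g (padString τ) τ.length).1}, ?_, fun m => ?_⟩, hle⟩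
  · exact (ComputablePred.nat_le (Computable.nat_mul (Computable.const c) Computable.fst)
      (Computable.fst.comp ((computable_hitState_padString hσ hf hg).comp Computable.snd))).to_re
  · rw [openClass_setOf_padString (p := fun Y L => c * m ≤ (hitState σ f g Y L).1)
      fun Y Y' L h hY => by rwa [← hitState_congr h]]
    ext Y
    simp [hitsEver, hitsBy]

/-- Rounding a fraction to the nearest multiple of `2 ^ (-n)`. -/
theorem abs_sub_round_div_le (N D n : ℕ) (hD : 0 < D) :
    |(N : ℝ) / D - ((2 * N * 2 ^ n + D) / (2 * D) : ℕ) / 2 ^ n| ≤ (1 / 2 : ℝ) ^ (n + 1) := by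
  set A := (2 * N * 2 ^ n + D) / (2 * D)
  have hD' : (0 : ℝ) < D := by exact_mod_cast hD
  have h1 : A * (2 * D) ≤ 2 * N * 2 ^ n + D := Nat.div_mul_le_self _ _
  have h2 : 2 * N * 2 ^ n + D < (A + 1) * (2 * D) :=
    Nat.lt_mul_of_div_lt (Nat.lt_succ_self _) (by omega)
  have h1' : (A : ℝ) * (2 * D) ≤ 2 * N * 2 ^ n + D := by exact_mod_cast h1
  have h2' : 2 * (N : ℝ) * 2 ^ n + D < (A + 1) * (2 * D) := by exact_mod_cast h2
  have e : (N : ℝ) / D - A / 2 ^ n = (2 * N * 2 ^ n - A * (2 * D)) / (D * 2 ^ (n + 1)) := by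
    rw [pow_succ]
    field_simp
  have e' : (1 / 2 : ℝ) ^ (n + 1) * (D * 2 ^ (n + 1)) = D := by
    rw [div_pow, one_pow]
    field_simp
  rw [e, abs_div, abs_of_pos (by positivity : (0 : ℝ) < D * 2 ^ (n + 1)),
    div_le_iff₀ (by positivity), e', abs_le]
  constructor <;> linarith

/-- Stopping at stage `l m n` and rounding the resulting dyadic measure each cost at most `2 ^ (-(n
+ 1))`. -/
theorem isUniformlyComputableReal_hitsEver (hσ : Computable σ)
    (hf : ∀ i, Computable fun p : ℕ × ℕ => f p.1 i p.2) (hg : Computable g)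
    (hinj : ∀ n i, Function.Injective (f n i)) {v : ℕ → ℕ} (hvc : Computable v)
    (hv : ∀ n,
      coinMeasure ℕ (openClass (Set.range σ) \ cylindersBelow σ (v n)) ≤ (2⁻¹ : ℝ≥0∞) ^ n)
    (c : ℕ) :
    IsUniformlyComputableReal fun m => (coinMeasure ℕ (hitsEver σ f g (c * m))).toReal := by
  classical
  -- The summand `c * m * k` absorbs the factor `r * k` of the late-hit bound, with `r = c * m`.
  let l : ℕ → ℕ → ℕ := fun m n => manyHitsStage σ f g v (n + 1 + c * m * k) (c * m)
  let N : ℕ → ℕ → ℕ := fun m n => ∑ d ∈ Finset.range (2 ^ l m n),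
    if c * m ≤ (hitState σ f g d.testBit (l m n)).1 then 1 else 0
  have hcm : Computable fun p : ℕ × ℕ => c * p.1 :=
    Computable.nat_mul (Computable.const c) Computable.fst
  have hl : Computable fun p : ℕ × ℕ => l p.1 p.2 := by
    have hj : Computable fun p : ℕ × ℕ => p.2 + 1 + c * p.1 * k :=
      Computable.nat_add (Computable.nat_add Computable.snd (Computable.const 1))
        (Computable.nat_mul hcm (Computable.const k))
    exact (computable_manyHitsStage hσ hf hg hvc).comp (hj.pair hcm)
  have hst : Computable fun q : (ℕ × ℕ) × ℕ => hitState σ f g q.2.testBit (l q.1.1 q.1.2) := by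
    have hX : Computable fun q : ((ℕ × ℕ) × ℕ) × ℕ => q.1.2.testBit q.2 :=
      computable_testBit.comp (f := fun q : ℕ × ℕ => q.1.testBit q.2)
        (g := fun q : ((ℕ × ℕ) × ℕ) × ℕ => (q.1.2, q.2))
        ((Computable.snd.comp Computable.fst).pair Computable.snd)
    exact computable_hitState (X := fun q : (ℕ × ℕ) × ℕ => q.2.testBit) hσ hf hg hX
      (hl.comp Computable.fst)
  have hN : Computable fun p : ℕ × ℕ => N p.1 p.2 :=
    Computable.sum_range (h := fun (p : ℕ × ℕ) d =>
      if c * p.1 ≤ (hitState σ f g d.testBit (l p.1 p.2)).1 then 1 else 0)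
      (Computable.two_pow hl)
      (Computable.ite_of_pred
        (ComputablePred.nat_le (hcm.comp Computable.fst) (Computable.fst.comp hst))
        (Computable.const 1) (Computable.const 0))
  have hN2 : Computable fun p : ℕ × ℕ =>
      (2 * N p.1 p.2 * 2 ^ p.2 + 2 ^ l p.1 p.2) / (2 * 2 ^ l p.1 p.2) :=
    Computable.nat_div
      (Computable.nat_add (Computable.nat_mul (Computable.nat_mul (Computable.const 2) hN)
        (Computable.two_pow Computable.snd)) (Computable.two_pow hl))
      (Computable.nat_mul (Computable.const 2) (Computable.two_pow hl))
  refine ⟨fun m n => (2 * N m n * 2 ^ n + 2 ^ l m n) / (2 * 2 ^ l m n), fun _ _ => 0, hN2.to₂,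
    (Computable.const 0).to₂, fun m n => ?_⟩
  have hsub : hitsBy σ f g (c * m) (l m n) ⊆ hitsEver σ f g (c * m) := Set.subset_iUnion _ _
  have hmeas : MeasurableSet (hitsBy σ f g (c * m) (l m n)) :=
    measurableSet_hitState fun p => c * m ≤ p.1
  have hdiff : (coinMeasure ℕ).real (hitsEver σ f g (c * m) \ hitsBy σ f g (c * m) (l m n))
      ≤ (1 / 2 : ℝ) ^ (n + 1) := by
    have h1 := coinMeasure_hitsEver_diff_le (g := g) hinj hv (n + 1 + c * m * k) (c * m)
    rw [← mul_assoc, ← Nat.cast_mul] at h1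
    have h2 := ENNReal.toReal_mono (by simp) (h1.trans natCast_mul_two_inv_pow_le)
    rw [measureReal_def]
    refine h2.trans_eq ?_
    simp
  rw [measureReal_sdiff hsub hmeas] at hdiff
  have hpos := measureReal_mono (μ := coinMeasure ℕ) hsub
  have hcount : (coinMeasure ℕ).real (hitsBy σ f g (c * m) (l m n))
      = (N m n : ℝ) / (2 ^ l m n : ℕ) := by
    rw [Nat.cast_pow, Nat.cast_ofNat]
    exact coinMeasure_eq_count (p := fun Y => c * m ≤ (hitState σ f g Y (l m n)).1)
      fun Y Y' h hY => by rwa [← hitState_congr h]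
  have hround := abs_le.1 (abs_sub_round_div_le (N m n) (2 ^ l m n) n (by positivity))
  rw [← hcount] at hround
  have hhalf : (1 / 2 : ℝ) ^ n = (1 / 2 : ℝ) ^ (n + 1) + (1 / 2 : ℝ) ^ (n + 1) := by
    rw [pow_succ]; ring
  dsimp only
  rw [Nat.cast_zero, sub_zero, ← measureReal_def, hhalf, abs_le]
  constructor <;> linarith [hround.1, hround.2]

/-- The string `τ` witnesses some `n` without a hit from the first `t` strings; requiring `hitStage
σ (f n) t ≤ τ.length` ensures that only genuine bits of `τ` are consulted, never the padding. -/
theorem computablePred_escape (hσ : Computable σ)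
    (hf : ∀ i, Computable fun p : ℕ × ℕ => f p.1 i p.2) (t : ℕ) :
    ComputablePred fun τ : List Bool => ∃ n < τ.length, 1 ≤ n ∧ hitStage σ (f n) t ≤ τ.length ∧
      ∀ i, ∀ s < t, ¬∀ x < (σ s).length, padString τ (f n i x) = padString (σ s) x := by
  have hlen : Computable fun τ : List Bool => τ.length := Computable.list_length
  have h1 : ComputablePred fun a : List Bool × ℕ => 1 ≤ a.2 :=
    ComputablePred.nat_le (Computable.const 1) Computable.snd
  have hstage : Computable fun a : List Bool × ℕ => hitStage σ (f a.2) t :=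
    (computable_hitStage hσ hf).comp (Computable.snd.pair (Computable.const t))
  have h2 : ComputablePred fun a : List Bool × ℕ => hitStage σ (f a.2) t ≤ a.1.length :=
    ComputablePred.nat_le hstage (hlen.comp Computable.fst)
  have h3 : ∀ i, ComputablePred fun b : (List Bool × ℕ) × ℕ =>
      ∀ x < (σ b.2).length, padString b.1.1 (f b.1.2 i x) = padString (σ b.2) x := by
    intro i
    have hpair : Computable fun c : ((List Bool × ℕ) × ℕ) × ℕ => (c.1.1.2, c.2) :=
      (Computable.snd.comp (Computable.fst.comp Computable.fst)).pair Computable.snd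
    have hfi : Computable fun c : ((List Bool × ℕ) × ℕ) × ℕ => f c.1.1.2 i c.2 := by
      have h := (hf i).comp hpair
      exact h
    have hpair' : Computable fun c : ((List Bool × ℕ) × ℕ) × ℕ =>
        (c.1.1.1, f c.1.1.2 i c.2) :=
      (Computable.fst.comp (Computable.fst.comp Computable.fst)).pair hfi
    exact computablePred_forall_eq_padString
      (X := fun (b : (List Bool × ℕ) × ℕ) x => padString b.1.1 (f b.1.2 i x))
      (by have h := computable_padString.comp hpair'; exact h) (hσ.comp Computable.snd)
  have h4 : ComputablePred fun a : List Bool × ℕ => ∀ i, ∀ s < t,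
      ¬∀ x < (σ s).length, padString a.1 (f a.2 i x) = padString (σ s) x :=
    ComputablePred.forall_fintype fun i => ComputablePred.forall_lt
      (p := fun (a : List Bool × ℕ) s =>
        ¬∀ x < (σ s).length, padString a.1 (f a.2 i x) = padString (σ s) x)
      (Computable.const t) (h3 i).not
  exact ComputablePred.exists_lt hlen (h1.and (h2.and h4))

/-- If the open class is closed, then the sequences that are hit for all `n` form a `Π⁰₁` class. -/
theorem isPi01_forall_mem_hitSet (hσ : Computable σ)
    (hf : ∀ i, Computable fun p : ℕ × ℕ => f p.1 i p.2)
    (hopen : IsOpen (openClass (Set.range σ))ᶜ) :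
    IsPi01 {X | ∀ n, 1 ≤ n → X ∈ hitSet σ (f n)} := by
  -- `V` is closed, hence compact, so finitely many of its generating cylinders suffice.
  obtain ⟨t, ht⟩ : ∃ t, openClass (Set.range σ) = cylindersBelow σ t := by
    have hcpt : IsCompact (openClass (Set.range σ)) :=
      (isOpen_compl_iff.1 hopen).isCompact
    have hop : ∀ t, IsOpen (cylindersBelow σ t) := by
      intro t
      have : cylindersBelow σ t = ⋃ s ∈ Finset.range t, ⋂ x ∈ Finset.range (σ s).length,
          {Y | Y x = padString (σ s) x} := by
        ext Y
        simp [cylindersBelow, isInitialSegment_iff_padString]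
      rw [this]
      refine isOpen_biUnion fun s _ => isOpen_biInter_finset fun x _ => ?_
      exact (continuous_apply x : Continuous fun Y : ℕ → Bool => Y x).isOpen_preimage _
        (isOpen_discrete {padString (σ s) x})
    obtain ⟨t, ht⟩ := hcpt.elim_directed_cover (cylindersBelow σ) hop
      (iUnion_cylindersBelow σ).ge (cylindersBelow_mono σ).directed_le
    exact ⟨t, ht.antisymm (cylindersBelow_subset_openClass σ t)⟩
  let p : (ℕ → Bool) → ℕ → Prop := fun X L => ∃ n < L, 1 ≤ n ∧ hitStage σ (f n) t ≤ L ∧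
    ∀ i, ∀ s < t, ¬∀ x < (σ s).length, X (f n i x) = padString (σ s) x
  have hp : ∀ X, (∃ L, p X L) ↔ ∃ n, 1 ≤ n ∧ X ∉ hitSet σ (f n) := by
    intro X
    have h1 : ∀ n, X ∉ hitSet σ (f n) ↔
        ∀ i, ∀ s < t, ¬∀ x < (σ s).length, X (f n i x) = padString (σ s) x := by
      intro n
      simp only [mem_hitSet_iff, ht, cylindersBelow, isInitialSegment_iff_padString,
        Set.mem_ofPred_eq, not_exists, not_and]
    simp only [h1, p]
    exact ⟨fun ⟨_, n, _, hn, _, h⟩ => ⟨n, hn, h⟩, fun ⟨n, hn, h⟩ =>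
      ⟨n + 1 + hitStage σ (f n) t, n, by omega, hn, by omega, h⟩⟩
  have hcongr : ∀ X X' L, (∀ x < L, X x = X' x) → p X L → p X' L := by
    rintro X X' L h ⟨n, hnL, hn, hL, hX⟩
    refine ⟨n, hnL, hn, hL, fun i s hs hc => hX i s hs fun x hx => ?_⟩
    rw [h _ ((lt_hitStage (f n) hs hx i).trans_le hL)]
    exact hc x hx
  refine ⟨{τ | p (padString τ) τ.length}, (computablePred_escape hσ hf t).to_re, ?_⟩
  rw [openClass_setOf_padString hcongr]
  ext X
  rw [Set.mem_ofPred_eq, hp]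
  simp

/-- Recurrence in Cantor space: if `Y` is random, then one of the searches along the maps `f n`,
`n ≥ 1`, fails. -/
theorem exists_notMem_hitSet (hσ : Computable σ)
    (hf : ∀ i, Computable fun p : ℕ × ℕ => f p.1 i p.2)
    (hinj : ∀ n i, Function.Injective (f n i)) (hg : Computable g)
    (hnew : ∀ M, ∀ n ≥ g M, ∀ i x, M ≤ f n i x)
    (hsep : ∀ M, ∀ n ≥ g M, ∀ i j, ∀ x < M, ∀ y < M, f n i x = f n j y → i = j ∧ x = y)
    (hpos : 0 < coinMeasure ℕ (openClass (Set.range σ))ᶜ) (Y : ℕ → Bool) :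
    (IsKurtzRandom Y → IsOpen (openClass (Set.range σ))ᶜ → ∃ n, 1 ≤ n ∧ Y ∉ hitSet σ (f n)) ∧
    (IsSchnorrRandom Y → IsComputableReal (coinMeasure ℕ (openClass (Set.range σ))ᶜ).toReal →
      ∃ n, 1 ≤ n ∧ Y ∉ hitSet σ (f n)) ∧
    (IsMLRandom Y → ∃ n, 1 ≤ n ∧ Y ∉ hitSet σ (f n)) := by
  obtain ⟨N, q, hq1, hq⟩ := exists_coinMeasure_hitSet_le hinj (fun M => ⟨g M, hsep M⟩) hpos
  -- Adding `N + 1` ensures both `G M ≥ N`, for the bound `q`, and `G M ≥ 1`, for recurrence.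
  let G : ℕ → ℕ := fun M => g M + (N + 1)
  have hG : Computable G := Computable.nat_add hg (Computable.const (N + 1))
  have hr : ∀ r, coinMeasure ℕ (hitsEver σ f G r) ≤ q ^ r :=
    coinMeasure_hitsEver_le (fun M => hnew M _ (Nat.le_add_right _ _))
      fun M => hq _ (by simp only [G]; omega)
  have hmem : ∀ X : ℕ → Bool, (∀ n, 1 ≤ n → X ∈ hitSet σ (f n)) → ∀ r, X ∈ hitsEver σ f G r :=
    fun X hX => mem_hitsEver_of_forall fun M => hX _ (by simp only [G]; omega)
  have hq0 := ENNReal.tendsto_pow_atTop_nhds_zero_of_lt_one hq1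
  -- Then `q ^ (c * m) ≤ 2 ^ (-m)`, as a test requires.
  obtain ⟨c, hc⟩ : ∃ c, q ^ c ≤ 2⁻¹ :=
    ((hq0.eventually_lt_const (by simp : (0 : ℝ≥0∞) < 2⁻¹)).exists).imp fun _ => le_of_lt
  have htest : IsMLTest fun m => hitsEver σ f G (c * m) := isMLTest_hitsEver hσ hf hG fun m =>
    (hr _).trans (by rw [pow_mul]; gcongr)
  refine ⟨fun hY hopen => ?_, fun hY hcomp => ?_, fun hY => ?_⟩
  · by_contra! hcon
    refine hY {X | ∀ n, 1 ≤ n → X ∈ hitSet σ (f n)} (isPi01_forall_mem_hitSet hσ hf hopen) ?_ hcon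
    exact le_antisymm (ge_of_tendsto' hq0 fun r =>
      (measure_mono fun X hX => hmem X hX r).trans (hr r)) zero_le
  · by_contra! hcon
    obtain ⟨v, hvc, hv⟩ := exists_computable_modulus hσ hcomp
    exact hY _ ⟨htest, isUniformlyComputableReal_hitsEver hσ hf hG hinj hvc hv c⟩
      (Set.mem_iInter.2 fun m => hmem Y hcon _)
  · by_contra! hcon
    exact hY _ htest (Set.mem_iInter.2 fun m => hmem Y hcon _)

end Recurrence

/-! ### The face shifts as coordinate maps on Cantor space. -/

section FaceShift

variable {k : ℕ}

/-- Bit `x` of the sequence that codes `T_i^n Z` is bit `shiftIndex e n i x` of the sequence that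
codes `Z`. -/
def shiftIndex (e : (Fin k → ℕ) ≃ ℕ) (n : ℕ) (i : Fin k) (x : ℕ) : ℕ :=
  e (Function.update (e.symm x) i (e.symm x i + n))

theorem faceShift_iterate (i : Fin k) (n : ℕ) (Z : (Fin k → ℕ) → Bool) (u : Fin k → ℕ) :
    (faceShift i)^[n] Z u = Z (Function.update u i (u i + n)) := by
  induction n generalizing u with
  | zero => simp
  | succ n ih =>
    rw [Function.iterate_succ_apply', faceShift, ih]
    congr 1
    simp only [Function.update_self, Function.update_idem]
    congr 1
    omega

theorem toCantor_faceShift_iterate (e : (Fin k → ℕ) ≃ ℕ) (i : Fin k) (n : ℕ)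
    (Z : (Fin k → ℕ) → Bool) :
    toCantor e ((faceShift i)^[n] Z) = fun x => toCantor e Z (shiftIndex e n i x) := by
  funext x
  simp [toCantor, shiftIndex, Equiv.arrowCongr, faceShift_iterate]

theorem isRecurrentIn_iff (e : (Fin k → ℕ) ≃ ℕ) (Z : (Fin k → ℕ) → Bool)
    (P : Set ((Fin k → ℕ) → Bool)) :
    IsRecurrentIn Z P ↔ ∃ n, 1 ≤ n ∧
      ∀ i, (fun x => toCantor e Z (shiftIndex e n i x)) ∈ toCantor e '' P := by
  simp only [IsRecurrentIn, Set.mem_iInter, Set.mem_preimage, ← toCantor_faceShift_iterate,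
    (toCantor e).injective.mem_set_image]

theorem primrec_update_add (i : Fin k) :
    Primrec fun p : (Fin k → ℕ) × ℕ => Function.update p.1 i (p.1 i + p.2) := by
  rw [Primrec.fin_curry]
  have hu : Primrec fun q : ((Fin k → ℕ) × ℕ) × Fin k => q.1.1 q.2 :=
    Primrec.fin_app.comp (Primrec.fst.comp Primrec.fst) Primrec.snd
  have hui : Primrec fun q : ((Fin k → ℕ) × ℕ) × Fin k => q.1.1 i + q.1.2 :=
    Primrec.nat_add.comp (Primrec.fin_app.comp (Primrec.fst.comp Primrec.fst) (Primrec.const i))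
      (Primrec.snd.comp Primrec.fst)
  have hc : PrimrecPred fun q : ((Fin k → ℕ) × ℕ) × Fin k => q.2 = i :=
    Primrec.eq.comp Primrec.snd (Primrec.const i)
  exact (Primrec.ite hc hui hu).of_eq fun q => (Function.update_apply _ _ _ _).symm

theorem computable_shiftIndex {e : (Fin k → ℕ) ≃ ℕ} (he : Computable e) (i : Fin k) :
    Computable fun p : ℕ × ℕ => shiftIndex e p.1 i p.2 := by
  have hs := Computable.equiv_symm e he
  have hpair : Computable fun p : ℕ × ℕ => (e.symm p.2, p.1) :=
    (hs.comp Computable.snd).pair Computable.fst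
  have h := he.comp ((primrec_update_add i).to_comp.comp hpair)
  exact h

theorem update_add_injective (n : ℕ) (i : Fin k) :
    Function.Injective fun u : Fin k → ℕ => Function.update u i (u i + n) := by
  intro u v h
  funext j
  have hj := congrFun h j
  by_cases hji : j = i
  · subst hji
    simpa using hj
  · simpa [hji] using hj

theorem shiftIndex_injective (e : (Fin k → ℕ) ≃ ℕ) (n : ℕ) (i : Fin k) :
    Function.Injective (shiftIndex e n i) :=
  e.injective.comp ((update_add_injective n i).comp e.symm.injective)

/-- A bound on the coordinates of the first `M` indices. -/
def indexBound (e : (Fin k → ℕ) ≃ ℕ) (M : ℕ) : ℕ :=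
  1 + ∑ x ∈ Finset.range M, ∑ i, e.symm x i

theorem lt_indexBound (e : (Fin k → ℕ) ≃ ℕ) {M x : ℕ} (hx : x < M) (i : Fin k) :
    e.symm x i < indexBound e M := by
  have h1 := Finset.single_le_sum (f := fun i => e.symm x i) (fun _ _ => Nat.zero_le _)
    (Finset.mem_univ i)
  have h2 := Finset.single_le_sum (f := fun x => ∑ i, e.symm x i) (fun _ _ => Nat.zero_le _)
    (Finset.mem_range.2 hx)
  unfold indexBound
  omega

theorem computable_indexBound {e : (Fin k → ℕ) ≃ ℕ} (he : Computable e) :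
    Computable (indexBound e) := by
  have hs := Computable.equiv_symm e he
  have hsum : Computable fun p : ℕ × ℕ => ∑ i, e.symm p.2 i :=
    Computable.finset_sum Finset.univ fun i =>
      Computable.fin_app.comp (hs.comp Computable.snd) (Computable.const i)
  exact Computable.nat_add (Computable.const 1)
    (Computable.sum_range (h := fun _ x => ∑ i, e.symm x i) Computable.id hsum)

/-- The tuple coded by the shifted index has `i`-th coordinate at least `n`, whereas tuples with
codes below `M` have all coordinates below `indexBound e M`. -/
theorem le_shiftIndex (e : (Fin k → ℕ) ≃ ℕ) {M n : ℕ} (hn : indexBound e M ≤ n) (i : Fin k)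
    (x : ℕ) : M ≤ shiftIndex e n i x := by
  by_contra hlt
  have h := lt_indexBound e (not_le.1 hlt) i
  rw [shiftIndex, Equiv.symm_apply_apply, Function.update_self] at h
  omega

/-- If `i ≠ j`, compare `i`-th coordinates: on the left it is at least `n`, on the right it is that
of `e.symm y`, which is below `indexBound e M`. -/
theorem eq_of_shiftIndex_eq (e : (Fin k → ℕ) ≃ ℕ) {M n : ℕ} (hn : indexBound e M ≤ n)
    {i j : Fin k} {x y : ℕ} (hy : y < M) (h : shiftIndex e n i x = shiftIndex e n j y) :
    i = j ∧ x = y := by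
  have hij : i = j := by
    by_contra hij
    have h1 := congrFun (e.injective h) i
    rw [Function.update_self, Function.update_of_ne hij] at h1
    have h2 := lt_indexBound e hy i
    omega
  subst hij
  exact ⟨rfl, shiftIndex_injective e n i h⟩

theorem coinMeasure_image_toCantor (e : (Fin k → ℕ) ≃ ℕ) {P : Set ((Fin k → ℕ) → Bool)}
    (hP : MeasurableSet (toCantor e '' P)) :
    coinMeasure ℕ (toCantor e '' P) = coinMeasure (Fin k → ℕ) P := by
  rw [← (measurePreserving_comp_coinMeasure e.symm.injective).measure_preimage hP.nullMeasurableSet]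
  congr 1
  exact Set.preimage_image_eq P (toCantor e).injective

theorem isOpen_image_toCantor (e : (Fin k → ℕ) ≃ ℕ) {P : Set ((Fin k → ℕ) → Bool)}
    (hP : IsOpen P) : IsOpen (toCantor e '' P) := by
  rw [Equiv.image_eq_preimage_symm]
  refine hP.preimage ?_
  exact continuous_pi fun u => continuous_apply (e u)

end FaceShift

/-! ### Transfer of recurrence from Cantor space to arrays. -/

theorem mainTheorem4 (k : ℕ) (hk : 1 ≤ k)
    (e : (Fin k → ℕ) ≃ ℕ) (he : Computable e)
    (P : Set ((Fin k → ℕ) → Bool)) (hP : IsPi01 (toCantor e '' P))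
    (hpos : 0 < coinMeasure (Fin k → ℕ) P) (Z : (Fin k → ℕ) → Bool) :
    (IsKurtzRandom (toCantor e Z) → IsClopen P → IsRecurrentIn Z P) ∧
    (IsSchnorrRandom (toCantor e Z) →
      IsComputableReal (coinMeasure (Fin k → ℕ) P).toReal → IsRecurrentIn Z P) ∧
    (IsMLRandom (toCantor e Z) → IsRecurrentIn Z P) := by
  obtain ⟨S, hS, hSP⟩ := hP
  -- Only a nonempty c.e. set has a computable enumeration; if `S` is empty, then `P` is the whole
  -- space and `n = 1` works.
  rcases S.eq_empty_or_nonempty with rfl | ⟨τ₀, hτ₀⟩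
  · have huniv : toCantor e '' P = Set.univ := by
      rw [← Set.compl_empty_iff, hSP]
      exact Set.eq_empty_of_forall_notMem fun Y ⟨_, h, _⟩ => h
    have hrec : IsRecurrentIn Z P := (isRecurrentIn_iff e Z P).2
      ⟨1, le_rfl, fun i => by rw [huniv]; trivial⟩
    exact ⟨fun _ _ => hrec, fun _ _ => hrec, fun _ => hrec⟩
  obtain ⟨σ, hσ, hσS⟩ := hS.exists_computable_range hτ₀
  obtain rfl : S = Set.range σ := Set.ext hσS
  have hPV : toCantor e '' P = (openClass (Set.range σ))ᶜ := by rw [← hSP, compl_compl]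
  have hμ : coinMeasure ℕ (openClass (Set.range σ))ᶜ = coinMeasure (Fin k → ℕ) P := by
    rw [← hPV]
    refine coinMeasure_image_toCantor e ?_
    rw [hPV]
    exact (measurableSet_openClass_range σ).compl
  have hrec : (∃ n, 1 ≤ n ∧ toCantor e Z ∉ hitSet σ (shiftIndex e n)) → IsRecurrentIn Z P := by
    rintro ⟨n, hn, hZ⟩
    rw [mem_hitSet_iff, not_exists] at hZ
    refine (isRecurrentIn_iff e Z P).2 ⟨n, hn, fun i => ?_⟩
    rw [hPV]
    exact hZ i
  obtain ⟨hKurtz, hSchnorr, hML⟩ := exists_notMem_hitSet hσ (computable_shiftIndex he)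
    (shiftIndex_injective e) (computable_indexBound he) (fun _ _ hn => le_shiftIndex e hn)
    (fun _ _ hn _ _ _ _ _ hy => eq_of_shiftIndex_eq e hn hy) (by rwa [hμ]) (toCantor e Z)
  refine ⟨fun hZ hcl => hrec (hKurtz hZ ?_), fun hZ hc => hrec (hSchnorr hZ ?_),
    fun hZ => hrec (hML hZ)⟩
  · rw [← hPV]
    exact isOpen_image_toCantor e hcl.isOpen
  · rwa [hμ]
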